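/- Let $S$ be an inverse semigroup with unit $1$; write $s^*$ for the generalized inverse of $s$ and $s\le t$ if $s=te$ for some idempotent $e$. A (not necessarily saturated) Fell bundle $\mathcal A=(A_s)_{s\in S}$ over $S$ consists of complex Banach spaces $A_s$, bilinear associative multiplications $A_s\times A_t\to A_{st}$ with $\|ab\|\le\|a\|\|b\|$, isometric conjugate-linear involutions $A_s\to A_{s^*}$ with $a^{**}=a$ and $(ab)^*=b^*a^*$, and isometric linear inclusions $A_s\subseteq A_t$ for $s\le t$, functorial and compatible with multiplication and involution, such that $\|a^*a\|=\|a\|^2$ and $a^*a$ is a positive element of the $C^*$-algebra $A_{s^*s}$ for every $a\in A_s$. Let $C_c(\mathcal A)$ be the $^*$-algebra of finitely supported sections, spanned by elements $a\delta_s$ ($a\in A_s$), with $(a\delta_s)(b\delta_t)=(ab)\delta_{st}$ and $(a\delta_s)^*=a^*\delta_{s^*}$. The full cross-sectional $C^*$-algebra $C^*(\mathcal A)$ is the Hausdorff completion of $C_c(\mathcal A)$ in the largest $C^*$-seminorm that vanishes on all $a\delta_s-a\delta_t$ with $s\le t$ and $a\in A_s\subseteq A_t$. View all $A_s$ inside $C^*(\mathcal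 A)\subseteq C^*(\mathcal A)''$, the enveloping von Neumann algebra, and let $A_s''$ be the weak closure of $A_s$ there. For $s\in S$ let $I_{s,1}$ be the closed ideal of $A_1$ generated by the $A_{v^*v}$ with $v\le s$ and $v\le 1$, and let $1_s$ be the unit of $I_{s,1}''$. Let $C_c(\mathcal A'')$ be the space of finitely supported sections of $(A_s'')_{s\in S}$, with the multiplication and involution given by the same formulas, and let $P''\colon C_c(\mathcal A'')\to A_1''$ be the linear map with $P''(x\delta_s)=x1_s$. Let $\ell^2(\mathcal A'')$ be the Hausdorff completion of $C_c(\mathcal A'')$ in the norm $\|\langle\xi,\xi\rangle\|^{1/2}$ coming from the $A_1''$-valued semi-inner product $\langle\xi,\eta\rangle=P''(\xi^*\eta)$, and let $\Lambda(x)$, $x\in C_c(\mathcal A)$, be the operator of left multiplication by $x$ on $\ell^2(\mathcal A'')$. The reduced cross-sectional $C^*$-algebra $C^*_r(\mathcal A)$ is the Hausdorff completion of $C_c(\mathcal A)$ in the seminorm $\|x\|_r=\|\Lambda(x)\|$; the identity of $C_c(\mathcal A)$ extends to a $^*$-homomorphism $\Lambda\colon C^*(\mathcal A)\to C^*_r(\mathcal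 A)$, the regular representation. $\mathcal A$ has the approximation property if there is a net $(\xi_i)_{i\in I}$ of finitely supported functions $\xi_i\colon S\to A_1$ with $\xi_i(s)\in A_{ss^*}$ for all $s\in S$, such that (i) $\sup_{i}\bigl\|\sum_{p,t\in S}\xi_i(p)^*\xi_i(t)\,1_{pt^*}\bigr\|<\infty$, and (ii) for all $s\in S$ and $a\in A_s$, $\ \sum_{p,t\in S}1_{p(st)^*}\,\xi_i(p)^*\,a\,\xi_i(t)\to a$ in norm. **Theorem.** Let $\mathcal A$ be a Fell bundle over an inverse semigroup $S$ with unit. If $\mathcal A$ has the approximation property, then it has the weak containment property: the regular representation $\Lambda\colon C^*(\mathcal A)\to C^*_r(\mathcal A)$ is a $^*$-isomorphism. -/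

import Mathlib

universe u v w

/-- An inverse semigroup with unit: every `s` has a unique generalized inverse `s⁻¹`
(usually written `s^*`). -/
class InverseMonoid (S : Type u) extends Monoid S, Inv S where
  mul_inv_mul : ∀ s : S, s * s⁻¹ * s = s
  inv_mul_inv : ∀ s : S, s⁻¹ * s * s⁻¹ = s⁻¹
  inv_unique : ∀ s t : S, s * t * s = s → t * s * t = t → t = s⁻¹

namespace InverseMonoid

variable {S : Type u} [InverseMonoid S]

/-- The natural partial order: `s ≤ t` iff `s = t e` for some idempotent `e`. -/
instance instLE : LE S := ⟨fun s t => ∃ e : S, e * e = e ∧ t * e = s⟩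

theorem le_def {s t : S} : s ≤ t ↔ ∃ e : S, e * e = e ∧ t * e = s := Iff.rfl

theorem inv_inv' (s : S) : s⁻¹⁻¹ = s :=
  (inv_unique s⁻¹ s (inv_mul_inv s) (mul_inv_mul s)).symm

theorem inv_of_idem {e : S} (he : e * e = e) : e⁻¹ = e :=
  (inv_unique e e (by rw [he, he]) (by rw [he, he])).symm

theorem one_inv' : (1 : S)⁻¹ = 1 := inv_of_idem (mul_one 1)

theorem idem_inv_mul (s : S) : (s⁻¹ * s) * (s⁻¹ * s) = s⁻¹ * s := by
  rw [← mul_assoc, inv_mul_inv]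

theorem idem_mul_inv (s : S) : (s * s⁻¹) * (s * s⁻¹) = s * s⁻¹ := by
  rw [← mul_assoc, mul_inv_mul]

theorem idem_mul {e f : S} (he : e * e = e) (hf : f * f = f) :
    (e * f) * (e * f) = e * f := by
  have h1 := mul_inv_mul (e * f)
  have h2 := inv_mul_inv (e * f)
  set x := (e * f)⁻¹ with hx
  have hy : f * x * e = x := by
    apply inv_unique (e * f)
    · calc e * f * (f * x * e) * (e * f) = e * (f * f) * x * (e * e) * f := by
            simp only [mul_assoc]
        _ = e * f * x * (e * f) := by rw [he, hf]; simp only [mul_assoc]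
        _ = e * f := h1
    · calc f * x * e * (e * f) * (f * x * e) = f * (x * ((e * e) * (f * f)) * x) * e := by
            simp only [mul_assoc]
        _ = f * x * e := by rw [he, hf, h2]
  have hxx : x * x = x := by
    calc x * x = f * x * e * (f * x * e) := by rw [hy]
      _ = f * (x * (e * f) * x) * e := by simp only [mul_assoc]
      _ = x := by rw [h2, hy]
  have : e * f = x := by
    rw [← inv_inv' (e * f), ← hx, inv_of_idem hxx]
  rw [this, hxx]

theorem idem_comm {e f : S} (he : e * e = e) (hf : f * f = f) : e * f = f * e := by
  have h1 := idem_mul he hf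
  have h2 := idem_mul hf he
  have h : f * e = (e * f)⁻¹ := by
    apply inv_unique
    · calc e * f * (f * e) * (e * f) = e * (f * f) * (e * e) * f := by simp only [mul_assoc]
        _ = e * f * (e * f) := by rw [he, hf]; simp only [mul_assoc]
        _ = e * f := h1
    · calc f * e * (e * f) * (f * e) = f * (e * e) * (f * f) * e := by simp only [mul_assoc]
        _ = f * e * (f * e) := by rw [he, hf]; simp only [mul_assoc]
        _ = f * e := h2
  rw [h, inv_of_idem h1]

theorem mul_inv_rev' (s t : S) : (s * t)⁻¹ = t⁻¹ * s⁻¹ := by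
  symm
  have hc := idem_comm (idem_mul_inv t) (idem_inv_mul s)
  apply inv_unique
  · calc s * t * (t⁻¹ * s⁻¹) * (s * t) = s * ((t * t⁻¹) * (s⁻¹ * s)) * t := by
          simp only [mul_assoc]
      _ = (s * s⁻¹ * s) * (t * t⁻¹ * t) := by rw [hc]; simp only [mul_assoc]
      _ = s * t := by rw [mul_inv_mul, mul_inv_mul]
  · calc t⁻¹ * s⁻¹ * (s * t) * (t⁻¹ * s⁻¹) = t⁻¹ * ((s⁻¹ * s) * (t * t⁻¹)) * s⁻¹ := by
          simp only [mul_assoc]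
      _ = (t⁻¹ * t * t⁻¹) * (s⁻¹ * s * s⁻¹) := by rw [← hc]; simp only [mul_assoc]
      _ = t⁻¹ * s⁻¹ := by rw [inv_mul_inv, inv_mul_inv]

/-- Conjugates of idempotents are idempotent. -/
theorem idem_conj (s : S) {e : S} (he : e * e = e) :
    (s * e * s⁻¹) * (s * e * s⁻¹) = s * e * s⁻¹ := by
  calc (s * e * s⁻¹) * (s * e * s⁻¹) = s * (e * (s⁻¹ * s)) * e * s⁻¹ := by simp only [mul_assoc]
    _ = (s * s⁻¹ * s) * (e * e) * s⁻¹ := by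
        rw [idem_comm he (idem_inv_mul s)]; simp only [mul_assoc]
    _ = s * e * s⁻¹ := by rw [mul_inv_mul, he]

theorem idem_mul_eq {e : S} (he : e * e = e) (t : S) : e * t = t * (t⁻¹ * e * t) := by
  calc e * t = e * (t * t⁻¹) * t := by rw [mul_assoc, mul_inv_mul]
    _ = t * (t⁻¹ * e * t) := by rw [idem_comm he (idem_mul_inv t)]; simp only [mul_assoc]

theorem idem_conj' (s : S) {e : S} (he : e * e = e) :
    (s⁻¹ * e * s) * (s⁻¹ * e * s) = s⁻¹ * e * s := by
  simpa only [inv_inv'] using idem_conj s⁻¹ he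

theorem le_of_eq' {s t : S} (h : s = t) : s ≤ t := ⟨1, mul_one 1, by rw [mul_one, h]⟩

theorem le_refl' (s : S) : s ≤ s := le_of_eq' rfl

theorem le_trans' {r s t : S} (h₁ : r ≤ s) (h₂ : s ≤ t) : r ≤ t := by
  obtain ⟨e, he, rfl⟩ := h₁
  obtain ⟨f, hf, rfl⟩ := h₂
  exact ⟨f * e, idem_mul hf he, (mul_assoc _ _ _).symm⟩

theorem mul_le_mul'' {r r' s s' : S} (h₁ : r ≤ r') (h₂ : s ≤ s') : r * s ≤ r' * s' := by
  obtain ⟨e, he, rfl⟩ := h₁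
  obtain ⟨f, hf, rfl⟩ := h₂
  refine ⟨(s'⁻¹ * e * s') * f, idem_mul (idem_conj' s' he) hf, ?_⟩
  calc r' * s' * (s'⁻¹ * e * s' * f) = r' * (s' * (s'⁻¹ * e * s')) * f := by
        simp only [mul_assoc]
    _ = r' * e * (s' * f) := by rw [← idem_mul_eq he]; simp only [mul_assoc]

theorem inv_le_inv' {s t : S} (h : s ≤ t) : s⁻¹ ≤ t⁻¹ := by
  obtain ⟨e, he, rfl⟩ := h
  refine ⟨t * e * t⁻¹, idem_conj t he, ?_⟩
  rw [mul_inv_rev', inv_of_idem he, idem_mul_eq he t⁻¹, inv_inv']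

theorem idem_le_one {e : S} (he : e * e = e) : e ≤ 1 := ⟨e, he, one_mul e⟩

theorem inv_mul_le_one (s : S) : s⁻¹ * s ≤ 1 := idem_le_one (idem_inv_mul s)

theorem mul_inv_le_one (s : S) : s * s⁻¹ ≤ 1 := idem_le_one (idem_mul_inv s)

theorem idem_of_le_one {e : S} (h : e ≤ 1) : e * e = e := by
  obtain ⟨f, hf, rfl⟩ := h
  rw [one_mul, hf]

theorem mul_idem_le (s : S) {e : S} (he : e * e = e) : s * e ≤ s := ⟨e, he, rfl⟩

theorem idem_mul_le {e : S} (he : e * e = e) (s : S) : e * s ≤ s :=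
  ⟨s⁻¹ * e * s, idem_conj' s he, (idem_mul_eq he s).symm⟩

theorem le_inv_of_idem_le {e s : S} (he : e * e = e) (h : e ≤ s) : e ≤ s⁻¹ := by
  simpa only [inv_of_idem he] using inv_le_inv' h

theorem conj_inv_mul_self (s : S) : (s⁻¹ * s)⁻¹ * (s⁻¹ * s) = s⁻¹ * s := by
  rw [inv_of_idem (idem_inv_mul s), idem_inv_mul]

end InverseMonoid

open InverseMonoid

/-- A (not necessarily saturated) Fell bundle over an inverse semigroup `S` with unit, with its
multiplication maps, involutions and inclusion maps. The inclusions along equalities `s = t` serve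
to compare fibres whose indices are equal but not syntactically so. The fibre `A_s` is a Hilbert
`A_1`-`A_1`-bimodule with inner products `a^* b` and `a b^*`. -/
structure FellBundle (S : Type u) [InverseMonoid S] where
  /-- the fibre `A_s`, a Banach space -/
  fiber : S → Type v
  [normedAddCommGroup : ∀ s, NormedAddCommGroup (fiber s)]
  [normedSpace : ∀ s, NormedSpace ℂ (fiber s)]
  [completeSpace : ∀ s, CompleteSpace (fiber s)]
  /-- the multiplication `A_s × A_t → A_{st}` -/
  mul : ∀ {s t : S}, fiber s →ₗ[ℂ] fiber t →ₗ[ℂ] fiber (s * t)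
  /-- the involution `A_s → A_{s^*}` -/
  adj : ∀ {s : S}, fiber s →ₗ⋆[ℂ] fiber s⁻¹
  /-- the inclusion `A_s ⊆ A_t` for `s ≤ t` -/
  incl : ∀ {s t : S}, s ≤ t → (fiber s →ₗᵢ[ℂ] fiber t)
  incl_refl : ∀ {s : S} (h : s ≤ s) (a : fiber s), incl h a = a
  incl_trans : ∀ {r s t : S} (h₁ : r ≤ s) (h₂ : s ≤ t) (h₃ : r ≤ t) (a : fiber r),
    incl h₂ (incl h₁ a) = incl h₃ a
  mul_assoc' : ∀ {r s t : S} (a : fiber r) (b : fiber s) (c : fiber t),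
    incl (le_of_eq' (mul_assoc r s t)) (mul (mul a b) c) = mul a (mul b c)
  norm_mul_le' : ∀ {s t : S} (a : fiber s) (b : fiber t), ‖mul a b‖ ≤ ‖a‖ * ‖b‖
  adj_adj : ∀ {s : S} (a : fiber s), incl (le_of_eq' (inv_inv' s)) (adj (adj a)) = a
  adj_mul : ∀ {s t : S} (a : fiber s) (b : fiber t),
    incl (le_of_eq' (mul_inv_rev' s t)) (adj (mul a b)) = mul (adj b) (adj a)
  norm_adj : ∀ {s : S} (a : fiber s), ‖adj a‖ = ‖a‖
  norm_adj_mul_self : ∀ {s : S} (a : fiber s), ‖mul (adj a) a‖ = ‖a‖ ^ 2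
  /-- `a^* a` is a positive element of the C*-algebra `A_{s^* s}` -/
  adj_mul_self_pos : ∀ {s : S} (a : fiber s), ∃ b : fiber (s⁻¹ * s),
    mul (adj a) a = incl (le_of_eq' (conj_inv_mul_self s)) (mul (adj b) b)
  incl_mul : ∀ {r r' s s' : S} (hr : r ≤ r') (hs : s ≤ s') (a : fiber r) (b : fiber s),
    incl (mul_le_mul'' hr hs) (mul a b) = mul (incl hr a) (incl hs b)
  incl_adj : ∀ {s t : S} (h : s ≤ t) (a : fiber s), incl (inv_le_inv' h) (adj a) = adj (incl h a)

attribute [instance] FellBundle.normedAddCommGroup FellBundle.normedSpace FellBundle.completeSpace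

/-- A C*-seminorm on a complex *-algebra. -/
structure CStarSeminorm (Q : Type u) [NonUnitalRing Q] [StarRing Q] [Module ℂ Q] extends
    Seminorm ℂ Q where
  mul_le' : ∀ x y : Q, toFun (x * y) ≤ toFun x * toFun y
  star_mul_self' : ∀ x : Q, toFun (star x * x) = toFun x ^ 2

namespace CStarSeminorm

variable {Q : Type u} [NonUnitalRing Q] [StarRing Q] [Module ℂ Q]

/-- Build a C*-seminorm from a submultiplicative seminorm with `p x ^ 2 ≤ p (x^* x)`. -/
def ofLe (p : Seminorm ℂ Q) (hmul : ∀ x y : Q, p (x * y) ≤ p x * p y)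
    (hstar : ∀ x : Q, p x ^ 2 ≤ p (star x * x)) : CStarSeminorm Q where
  toSeminorm := p
  mul_le' := hmul
  star_mul_self' x := by
    have key : ∀ y : Q, p y ≤ p (star y) := fun y => by
      by_contra! hlt
      have h1 := (hstar y).trans (hmul (star y) y)
      have h0 : 0 ≤ p (star y) := apply_nonneg p _
      nlinarith
    refine le_antisymm ?_ (hstar x)
    have h2 : p (star x) ≤ p x := by simpa using key (star x)
    calc p (star x * x) ≤ p (star x) * p x := hmul _ _
      _ ≤ p x * p x := by gcongr
      _ = p x ^ 2 := (sq _).symm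

theorem map_star (p : CStarSeminorm Q) (x : Q) : p.toSeminorm (star x) = p.toSeminorm x := by
  have key : ∀ y : Q, p.toSeminorm y ≤ p.toSeminorm (star y) := fun y => by
    by_contra! hlt
    have h1 : p.toSeminorm y ^ 2 ≤ p.toSeminorm (star y) * p.toSeminorm y :=
      (p.star_mul_self' y).symm.le.trans (p.mul_le' _ _)
    have h0 : 0 ≤ p.toSeminorm (star y) := apply_nonneg _ _
    nlinarith
  exact le_antisymm (by simpa using key (star x)) (key x)

set_option linter.unusedVariables false in
/-- The *-algebra `Q`, regarded as a seminormed space through `p`. -/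
def Carrier (p : CStarSeminorm Q) : Type u := Q

variable (p : CStarSeminorm Q)

instance : NonUnitalRing p.Carrier := inferInstanceAs (NonUnitalRing Q)
instance : StarRing p.Carrier := inferInstanceAs (StarRing Q)
instance : Module ℂ p.Carrier := inferInstanceAs (Module ℂ Q)
instance [IsScalarTower ℂ Q Q] : IsScalarTower ℂ p.Carrier p.Carrier :=
  inferInstanceAs (IsScalarTower ℂ Q Q)
instance [SMulCommClass ℂ Q Q] : SMulCommClass ℂ p.Carrier p.Carrier :=
  inferInstanceAs (SMulCommClass ℂ Q Q)
instance [StarModule ℂ Q] : StarModule ℂ p.Carrier := inferInstanceAs (StarModule ℂ Q)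

/-- The identity map `Q → p.Carrier`. -/
def toCarrier : Q →ₗ[ℂ] p.Carrier := LinearMap.id

noncomputable instance : SeminormedAddCommGroup p.Carrier :=
  AddGroupSeminorm.toSeminormedAddCommGroup (E := p.Carrier)
    { toFun := p.toFun, map_zero' := p.map_zero', add_le' := p.add_le', neg' := p.neg' }

noncomputable instance : NonUnitalSeminormedRing p.Carrier where
  __ := (inferInstance : SeminormedAddCommGroup p.Carrier)
  __ := (inferInstance : NonUnitalRing p.Carrier)
  norm_mul_le := p.mul_le'

noncomputable instance : NormedSpace ℂ p.Carrier where
  norm_smul_le c x := (p.smul' c x).le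

instance : NormedStarGroup p.Carrier where
  norm_star_le x := (p.map_star x).le

theorem norm_toCarrier (x : Q) : ‖p.toCarrier x‖ = p.toSeminorm x := rfl

open UniformSpace UniformSpace.Completion Function

/-- The Hausdorff completion of `Q` with respect to the C*-seminorm `p`; it is a C*-algebra. -/
abbrev Compl : Type u := UniformSpace.Completion p.Carrier

noncomputable instance : Mul p.Compl :=
  ⟨curry <| (isDenseInducing_coe.prodMap isDenseInducing_coe).extend
    ((fun x : p.Carrier => (x : p.Compl)) ∘ uncurry (· * ·))⟩

theorem coe_mul' (a b : p.Carrier) : ((a * b : p.Carrier) : p.Compl) = a * b :=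
  ((isDenseInducing_coe.prodMap isDenseInducing_coe).extend_eq
    ((continuous_coe p.Carrier).comp (continuous_mul (M := p.Carrier))) (a, b)).symm

instance : ContinuousMul p.Compl where
  continuous_mul := by
    let m := (AddMonoidHom.mul : p.Carrier →+ p.Carrier →+ p.Carrier).compr₂ toCompl
    have : Continuous fun q : p.Carrier × p.Carrier => m q.1 q.2 :=
      (continuous_coe p.Carrier).comp continuous_mul
    have di : IsDenseInducing (toCompl : p.Carrier → p.Compl) := isDenseInducing_coe
    exact (di.extend_Z_bilin di this :)

noncomputable instance : Star p.Compl := ⟨Completion.map star⟩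

theorem uniformContinuous_star' : UniformContinuous (star : p.Carrier → p.Carrier) :=
  star_isometry.uniformContinuous

theorem coe_star' (a : p.Carrier) : ((star a : p.Carrier) : p.Compl) = star (a : p.Compl) :=
  (map_coe (uniformContinuous_star' p) a).symm

instance : ContinuousStar p.Compl := ⟨Completion.continuous_map⟩

noncomputable instance : NonUnitalRing p.Compl :=
  { (inferInstance : AddCommGroup p.Compl), (inferInstance : Mul p.Compl) with
    zero_mul a := by
      induction a using induction_on with
      | hp => exact isClosed_eq (by fun_prop) continuous_const
      | ih a => rw [← coe_zero, ← coe_mul', zero_mul]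
    mul_zero a := by
      induction a using induction_on with
      | hp => exact isClosed_eq (by fun_prop) continuous_const
      | ih a => rw [← coe_zero, ← coe_mul', mul_zero]
    mul_assoc a b c := by
      induction a, b, c using induction_on₃ with
      | hp => exact isClosed_eq (by fun_prop) (by fun_prop)
      | ih a b c => rw [← coe_mul', ← coe_mul', ← coe_mul', ← coe_mul', mul_assoc]
    left_distrib a b c := by
      induction a, b, c using induction_on₃ with
      | hp => exact isClosed_eq (by fun_prop) (by fun_prop)
      | ih a b c => rw [← coe_add, ← coe_mul', ← coe_mul', ← coe_mul', ← coe_add, mul_add]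
    right_distrib a b c := by
      induction a, b, c using induction_on₃ with
      | hp => exact isClosed_eq (by fun_prop) (by fun_prop)
      | ih a b c => rw [← coe_add, ← coe_mul', ← coe_mul', ← coe_mul', ← coe_add, add_mul] }

noncomputable instance : StarRing p.Compl where
  star_involutive a := by
    induction a using induction_on with
    | hp => exact isClosed_eq (by fun_prop) continuous_id
    | ih a => rw [← coe_star', ← coe_star', star_star]
  star_mul a b := by
    induction a, b using induction_on₂ with
    | hp => exact isClosed_eq (by fun_prop) (by fun_prop)
    | ih a b => rw [← coe_mul', ← coe_star', ← coe_star', ← coe_star', star_mul, coe_mul']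
  star_add a b := by
    induction a, b using induction_on₂ with
    | hp => exact isClosed_eq (by fun_prop) (by fun_prop)
    | ih a b => rw [← coe_add, ← coe_star', ← coe_star', ← coe_star', star_add, coe_add]

noncomputable instance : NonUnitalNormedRing p.Compl where
  __ := (inferInstance : NormedAddCommGroup p.Compl)
  __ := (inferInstance : NonUnitalRing p.Compl)
  norm_mul_le a b := by
    induction a, b using induction_on₂ with
    | hp => exact isClosed_le (by fun_prop) (by fun_prop)
    | ih a b => rw [← coe_mul', norm_coe, norm_coe, norm_coe]; exact norm_mul_le a b

instance : CStarRing p.Compl where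
  norm_mul_self_le a := by
    induction a using induction_on with
    | hp => exact isClosed_le (by fun_prop) (by fun_prop)
    | ih a =>
      rw [← coe_star', ← coe_mul', norm_coe, norm_coe, ← sq]
      exact (p.star_mul_self' a).symm.le

instance [IsScalarTower ℂ Q Q] : IsScalarTower ℂ p.Compl p.Compl where
  smul_assoc c a b := by
    rw [smul_eq_mul, smul_eq_mul]
    induction a, b using induction_on₂ with
    | hp =>
      exact isClosed_eq ((continuous_fst.const_smul c).mul continuous_snd)
        ((continuous_fst.mul continuous_snd).const_smul c)
    | ih a b => rw [← coe_smul, ← coe_mul', ← coe_mul', ← coe_smul, smul_mul_assoc]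

instance [SMulCommClass ℂ Q Q] : SMulCommClass ℂ p.Compl p.Compl where
  smul_comm c a b := by
    rw [smul_eq_mul, smul_eq_mul]
    induction a, b using induction_on₂ with
    | hp =>
      exact isClosed_eq ((continuous_fst.mul continuous_snd).const_smul c)
        (continuous_fst.mul (continuous_snd.const_smul c))
    | ih a b => rw [← coe_smul, ← coe_mul', ← coe_mul', ← coe_smul, mul_smul_comm]

instance [StarModule ℂ Q] : StarModule ℂ p.Compl where
  star_smul c a := by
    induction a using induction_on with
    | hp =>
      exact isClosed_eq (continuous_id.const_smul c).star
        (continuous_star.const_smul (star c))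
    | ih a => rw [← coe_smul, ← coe_star', ← coe_star', ← coe_smul, star_smul]

noncomputable instance [IsScalarTower ℂ Q Q] [SMulCommClass ℂ Q Q] [StarModule ℂ Q] :
    NonUnitalCStarAlgebra p.Compl where

/-- The canonical *-homomorphism from `Q` to its completion. -/
noncomputable def toComplHom [IsScalarTower ℂ Q Q] [SMulCommClass ℂ Q Q] [StarModule ℂ Q] :
    Q →⋆ₙₐ[ℂ] p.Compl where
  toFun x := ((p.toCarrier x : p.Carrier) : p.Compl)
  map_smul' c x := coe_smul c (p.toCarrier x)
  map_zero' := coe_zero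
  map_add' x y := coe_add (p.toCarrier x) (p.toCarrier y)
  map_mul' x y := coe_mul' p (p.toCarrier x) (p.toCarrier y)
  map_star' x := coe_star' p (p.toCarrier x)

theorem norm_toComplHom [IsScalarTower ℂ Q Q] [SMulCommClass ℂ Q Q] [StarModule ℂ Q] (x : Q) : ‖p.toComplHom x‖ = p.toSeminorm x :=
  norm_coe (p.toCarrier x)

/-- The identity of `Q`, as a map between two seminormed copies of `Q`. -/
def changeSeminorm (p q : CStarSeminorm Q) : p.Carrier →ₗ[ℂ] q.Carrier :=
  (LinearMap.id : Q →ₗ[ℂ] Q)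

/-- If `q ≤ p`, the identity of `Q` extends to a *-homomorphism between the completions. -/
noncomputable def mapCompl [IsScalarTower ℂ Q Q] [SMulCommClass ℂ Q Q] [StarModule ℂ Q]
    (p q : CStarSeminorm Q) (h : ∀ x, q.toSeminorm x ≤ p.toSeminorm x) :
    p.Compl →⋆ₙₐ[ℂ] q.Compl :=
  have huc : UniformContinuous (changeSeminorm p q) :=
    (LipschitzWith.of_dist_le_mul (K := 1) fun x y => by
      rw [dist_eq_norm, dist_eq_norm, NNReal.coe_one, one_mul]
      exact h (x - y)).uniformContinuous
  have hc : Continuous (Completion.map (changeSeminorm p q)) := continuous_map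
  { toFun := Completion.map (changeSeminorm p q)
    map_smul' c a := by
      simp only [MonoidHom.id_apply]
      induction a using induction_on with
      | hp => exact isClosed_eq (hc.comp (continuous_const_smul c)) (hc.const_smul c)
      | ih a => rw [← coe_smul, map_coe huc, map_coe huc, map_smul, coe_smul]
    map_zero' := by rw [← coe_zero, map_coe huc, map_zero, coe_zero]
    map_add' a b := by
      induction a, b using induction_on₂ with
      | hp =>
        exact isClosed_eq (hc.comp continuous_add)
          ((hc.comp continuous_fst).add (hc.comp continuous_snd))
      | ih a b => rw [← coe_add, map_coe huc, map_coe huc, map_coe huc, map_add, coe_add]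
    map_mul' a b := by
      induction a, b using induction_on₂ with
      | hp =>
        exact isClosed_eq (hc.comp continuous_mul)
          ((hc.comp continuous_fst).mul (hc.comp continuous_snd))
      | ih a b =>
        rw [← coe_mul', map_coe huc, map_coe huc, map_coe huc, ← coe_mul']
        rfl
    map_star' a := by
      induction a using induction_on with
      | hp => exact isClosed_eq (hc.comp continuous_star) hc.star
      | ih a =>
        rw [← coe_star', map_coe huc, map_coe huc, ← coe_star']
        rfl }

theorem mapCompl_toComplHom [IsScalarTower ℂ Q Q] [SMulCommClass ℂ Q Q] [StarModule ℂ Q]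
    (p q : CStarSeminorm Q) (h : ∀ x, q.toSeminorm x ≤ p.toSeminorm x) (x : Q) :
    mapCompl p q h (p.toComplHom x) = q.toComplHom x := by
  have huc : UniformContinuous (changeSeminorm p q) :=
    (LipschitzWith.of_dist_le_mul (K := 1) fun x y => by
      rw [dist_eq_norm, dist_eq_norm, NNReal.coe_one, one_mul]
      exact h (x - y)).uniformContinuous
  exact map_coe huc (p.toCarrier x)

end CStarSeminorm

/-- A C*-seminorm on a C*-algebra is dominated by the norm. -/
theorem CStarSeminorm.le_norm {A : Type v} [NonUnitalCStarAlgebra A] (p : CStarSeminorm A) (a : A) :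
    p.toSeminorm a ≤ ‖a‖ := by
  rw [← p.norm_toComplHom]
  exact NonUnitalStarAlgHom.norm_apply_le p.toComplHom a

namespace FellBundle

variable {S : Type u} [InverseMonoid S] (𝒜 : FellBundle.{u, v} S)

/-! ### The unit fibre -/

/-- Multiplication in the unit fibre `A_1`. -/
noncomputable instance : Mul (𝒜.fiber 1) :=
  ⟨fun a b => 𝒜.incl (le_of_eq' (mul_one 1)) (𝒜.mul a b)⟩

/-- Involution in the unit fibre `A_1`. -/
noncomputable instance : Star (𝒜.fiber 1) := ⟨fun a => 𝒜.incl (le_of_eq' one_inv') (𝒜.adj a)⟩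

theorem unit_mul_def (a b : 𝒜.fiber 1) :
    a * b = 𝒜.incl (le_of_eq' (mul_one 1)) (𝒜.mul a b) := rfl

theorem unit_star_def (a : 𝒜.fiber 1) : star a = 𝒜.incl (le_of_eq' one_inv') (𝒜.adj a) := rfl

noncomputable instance : NonUnitalNormedRing (𝒜.fiber 1) where
  __ := 𝒜.normedAddCommGroup 1
  left_distrib a b c := by simp only [unit_mul_def, map_add]
  right_distrib a b c := by simp only [unit_mul_def, map_add, LinearMap.add_apply]
  zero_mul a := by simp only [unit_mul_def, map_zero, LinearMap.zero_apply]
  mul_zero a := by simp only [unit_mul_def, map_zero]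
  mul_assoc a b c := by
    simp only [unit_mul_def]
    have h1 := 𝒜.incl_mul (le_of_eq' (mul_one (1 : S))) (le_refl' 1) (𝒜.mul a b) c
    have h2 := 𝒜.incl_mul (le_refl' (1 : S)) (le_of_eq' (mul_one (1 : S))) a (𝒜.mul b c)
    rw [𝒜.incl_refl] at h1 h2
    rw [← h1, ← h2, ← 𝒜.mul_assoc' a b c]
    rw [𝒜.incl_trans _ _ (le_of_eq' (by simp)), 𝒜.incl_trans _ _ (le_of_eq' (by simp)),
      𝒜.incl_trans _ _ (le_of_eq' (by simp))]
  dist_eq := (𝒜.normedAddCommGroup 1).dist_eq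
  norm_mul_le a b := by
    rw [unit_mul_def, LinearIsometry.norm_map]
    exact 𝒜.norm_mul_le' a b

noncomputable instance : StarRing (𝒜.fiber 1) where
  star_involutive a := by
    simp only [unit_star_def]
    rw [← 𝒜.incl_adj, 𝒜.incl_trans _ _ (le_of_eq' (inv_inv' 1)), 𝒜.adj_adj]
  star_add a b := by simp only [unit_star_def, map_add]
  star_mul a b := by
    simp only [unit_star_def, unit_mul_def]
    rw [← 𝒜.incl_adj, ← 𝒜.incl_mul, ← 𝒜.adj_mul,
      𝒜.incl_trans _ _ (le_of_eq' (by rw [mul_one, one_inv'])),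
      𝒜.incl_trans _ _ (le_of_eq' (by rw [one_inv', mul_one])),
      𝒜.incl_trans _ _ (le_of_eq' (by rw [mul_one, one_inv']))]

theorem norm_unit_star_mul_self (a : 𝒜.fiber 1) : ‖star a * a‖ = ‖a‖ ^ 2 := by
  rw [unit_mul_def, unit_star_def, LinearIsometry.norm_map, ← 𝒜.norm_adj_mul_self a]
  have h := 𝒜.incl_mul (le_of_eq' (one_inv' (S := S))) (le_refl' 1) (𝒜.adj a) a
  rw [𝒜.incl_refl] at h
  rw [← h, LinearIsometry.norm_map]

/-- The unit fibre is a C*-algebra. -/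
noncomputable instance : NonUnitalCStarAlgebra (𝒜.fiber 1) where
  complete := (𝒜.completeSpace 1).complete
  norm_mul_self_le a := by rw [norm_unit_star_mul_self, sq]
  norm_smul_le c a := (norm_smul c a).le
  smul_assoc c a b := by
    simp only [smul_eq_mul, unit_mul_def, map_smul, LinearMap.smul_apply]
  smul_comm c a b := by simp only [smul_eq_mul, unit_mul_def, map_smul]
  star_smul c a := by
    simp only [unit_star_def, LinearMap.map_smulₛₗ, map_smul]
    rfl

/-! ### Finitely supported sections -/

/-- The *-algebra `C_c(𝒜)` of finitely supported sections, i.e. the algebraic direct sum of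
the fibres. -/
def Cc : Type (max u v) := DirectSum S 𝒜.fiber

noncomputable instance : AddCommGroup 𝒜.Cc := inferInstanceAs (AddCommGroup (DirectSum S 𝒜.fiber))
noncomputable instance : Module ℂ 𝒜.Cc := inferInstanceAs (Module ℂ (DirectSum S 𝒜.fiber))

open Classical in
/-- The section `a δ_s` with value `a` at `s` and zero elsewhere. -/
noncomputable def single (s : S) : 𝒜.fiber s →ₗ[ℂ] 𝒜.Cc := DirectSum.lof ℂ S 𝒜.fiber s

variable {N : Type w} [AddCommGroup N] [Module ℂ N]

open Classical in
/-- Linear maps out of `C_c(𝒜)` are given by families of linear maps on the fibres. -/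
noncomputable def lift (φ : ∀ s, 𝒜.fiber s →ₗ[ℂ] N) : 𝒜.Cc →ₗ[ℂ] N :=
  DirectSum.toModule ℂ S N φ

@[simp]
theorem lift_single (φ : ∀ s, 𝒜.fiber s →ₗ[ℂ] N) (s : S) (a : 𝒜.fiber s) :
    𝒜.lift φ (𝒜.single s a) = φ s a := by
  classical
  exact DirectSum.toModule_lof ℂ s a

theorem Cc.induction {motive : 𝒜.Cc → Prop} (zero : motive 0)
    (single : ∀ s a, motive (𝒜.single s a)) (add : ∀ x y, motive x → motive y → motive (x + y))
    (x : 𝒜.Cc) : motive x := by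
  classical
  exact DirectSum.induction_on (motive := motive) x zero single add

theorem single_incl_eq {s t : S} (h : s = t) (hle : s ≤ t) (a : 𝒜.fiber s) :
    𝒜.single t (𝒜.incl hle a) = 𝒜.single s a := by
  subst h
  rw [𝒜.incl_refl]

/-- The bilinear multiplication `(a δ_s) (b δ_t) = (a b) δ_{st}` of `C_c(𝒜)`. -/
noncomputable def mulHom : 𝒜.Cc →ₗ[ℂ] 𝒜.Cc →ₗ[ℂ] 𝒜.Cc :=
  𝒜.lift fun s => LinearMap.flip <| 𝒜.lift fun t =>
    (LinearMap.compr₂ (𝒜.mul (s := s) (t := t)) (𝒜.single (s * t))).flip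

noncomputable instance : Mul 𝒜.Cc := ⟨fun x y => 𝒜.mulHom x y⟩

theorem mul_def (x y : 𝒜.Cc) : x * y = 𝒜.mulHom x y := rfl

theorem single_mul_single {s t : S} (a : 𝒜.fiber s) (b : 𝒜.fiber t) :
    𝒜.single s a * 𝒜.single t b = 𝒜.single (s * t) (𝒜.mul a b) := by
  simp [mul_def, mulHom]

noncomputable instance : NonUnitalRing 𝒜.Cc where
  left_distrib x y z := by simp only [mul_def, map_add]
  right_distrib x y z := by simp only [mul_def, map_add, LinearMap.add_apply]
  zero_mul x := by simp only [mul_def, map_zero, LinearMap.zero_apply]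
  mul_zero x := by simp only [mul_def, map_zero]
  mul_assoc x y z := by
    induction x using Cc.induction with
    | zero => simp only [mul_def, map_zero, LinearMap.zero_apply]
    | add x x' hx hx' =>
      simp only [mul_def, map_add, LinearMap.add_apply] at hx hx' ⊢
      rw [hx, hx']
    | single r a =>
      induction y using Cc.induction with
      | zero => simp only [mul_def, map_zero, LinearMap.zero_apply]
      | add x x' hx hx' =>
        simp only [mul_def, map_add, LinearMap.add_apply] at hx hx' ⊢
        rw [hx, hx']
      | single s b =>
        induction z using Cc.induction with
        | zero => simp only [mul_def, map_zero]
        | add x x' hx hx' =>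
          simp only [mul_def, map_add] at hx hx' ⊢
          rw [hx, hx']
        | single t c =>
          rw [single_mul_single, single_mul_single, single_mul_single, single_mul_single,
            ← 𝒜.mul_assoc', single_incl_eq _ (mul_assoc r s t)]

instance : IsScalarTower ℂ 𝒜.Cc 𝒜.Cc where
  smul_assoc c x y := by simp only [smul_eq_mul, mul_def, map_smul, LinearMap.smul_apply]

instance : SMulCommClass ℂ 𝒜.Cc 𝒜.Cc where
  smul_comm c x y := by simp only [smul_eq_mul, mul_def, map_smul]

open Classical in
/-- The involution `(a δ_s)^* = a^* δ_{s^*}` of `C_c(𝒜)`. -/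
noncomputable def starHom : 𝒜.Cc →+ 𝒜.Cc :=
  DirectSum.toAddMonoid fun s =>
    (𝒜.single s⁻¹).toAddMonoidHom.comp (𝒜.adj (s := s)).toAddMonoidHom

noncomputable instance : Star 𝒜.Cc := ⟨fun x => 𝒜.starHom x⟩

theorem star_def (x : 𝒜.Cc) : star x = 𝒜.starHom x := rfl

theorem star_single {s : S} (a : 𝒜.fiber s) : star (𝒜.single s a) = 𝒜.single s⁻¹ (𝒜.adj a) := by
  classical
  exact DirectSum.toAddMonoid_of (β := 𝒜.fiber) _ s a

noncomputable instance : StarRing 𝒜.Cc where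
  star_involutive x := by
    induction x using Cc.induction with
    | zero => simp only [star_def, map_zero]
    | add x y hx hy =>
      simp only [star_def, map_add] at hx hy ⊢
      rw [hx, hy]
    | single s a =>
      rw [star_single, star_single]
      conv_rhs => rw [← 𝒜.adj_adj a, single_incl_eq _ (inv_inv' s)]
  star_add x y := by simp only [star_def, map_add]
  star_mul x y := by
    induction x using Cc.induction with
    | zero => simp only [zero_mul, star_def, map_zero, mul_zero]
    | add x x' hx hx' =>
      rw [add_mul]
      simp only [star_def, map_add, mul_add] at hx hx' ⊢
      rw [hx, hx']
    | single s a =>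
      induction y using Cc.induction with
      | zero => simp only [zero_mul, star_def, map_zero, mul_zero]
      | add x x' hx hx' =>
        rw [mul_add]
        simp only [star_def, map_add, add_mul] at hx hx' ⊢
        rw [hx, hx']
      | single t b =>
        rw [single_mul_single, star_single, star_single, star_single, single_mul_single,
          ← 𝒜.adj_mul, single_incl_eq _ (mul_inv_rev' s t)]

instance : StarModule ℂ 𝒜.Cc where
  star_smul c x := by
    induction x using Cc.induction with
    | zero => simp only [smul_zero, star_def, map_zero]
    | add x y hx hy =>
      rw [smul_add, star_add, star_add, smul_add, hx, hy]
    | single s a =>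
      rw [← map_smul, star_single, star_single, LinearMap.map_smulₛₗ, map_smul]
      rfl

/-! ### The full cross-sectional C*-algebra -/

/-- A C*-seminorm on `C_c(𝒜)` is admissible if it vanishes on the differences `a δ_s - a δ_t`,
`a ∈ A_s ⊆ A_t`, `s ≤ t`. It then vanishes on the *-ideal generated by them, so the admissible
C*-seminorms are those of the quotient *-algebra of `C_c(𝒜)` by this ideal. -/
def Admissible (p : CStarSeminorm 𝒜.Cc) : Prop :=
  ∀ (s t : S) (h : s ≤ t) (a : 𝒜.fiber s),
    p.toSeminorm (𝒜.single s a - 𝒜.single t (𝒜.incl h a)) = 0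

variable {𝒜}

theorem Admissible.eq_of_le {p : CStarSeminorm 𝒜.Cc} (hp : 𝒜.Admissible p) {s t : S} (h : s ≤ t)
    (a : 𝒜.fiber s) :
    p.toSeminorm (𝒜.single t (𝒜.incl h a)) = p.toSeminorm (𝒜.single s a) := by
  have h0 := hp s t h a
  have h1 := abs_sub_map_le_sub p.toSeminorm (𝒜.single s a) (𝒜.single t (𝒜.incl h a))
  rw [h0] at h1
  have := abs_eq_zero.mp (le_antisymm h1 (abs_nonneg _))
  linarith

theorem Admissible.single_le {p : CStarSeminorm 𝒜.Cc} (hp : 𝒜.Admissible p) {s : S}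
    (a : 𝒜.fiber s) : p.toSeminorm (𝒜.single s a) ≤ ‖a‖ := by
  let q : CStarSeminorm (𝒜.fiber 1) :=
    { toSeminorm := p.toSeminorm.comp (𝒜.single 1)
      mul_le' := fun x y => by
        have h : 𝒜.single 1 (x * y) = 𝒜.single 1 x * 𝒜.single 1 y := by
          rw [unit_mul_def, single_incl_eq _ (mul_one 1), single_mul_single]
        change p.toSeminorm (𝒜.single 1 (x * y)) ≤ _
        rw [h]
        exact p.mul_le' _ _
      star_mul_self' := fun x => by
        have h : 𝒜.single 1 (star x * x) = star (𝒜.single 1 x) * 𝒜.single 1 x := by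
          rw [unit_mul_def, single_incl_eq _ (mul_one 1), ← single_mul_single, star_single,
            unit_star_def, single_incl_eq _ one_inv']
        change p.toSeminorm (𝒜.single 1 (star x * x)) = _
        rw [h]
        exact p.star_mul_self' _ }
  have h1 : p.toSeminorm (𝒜.single s a) ^ 2 ≤ ‖a‖ ^ 2 := by
    have h2 : p.toSeminorm (star (𝒜.single s a) * 𝒜.single s a) = p.toSeminorm (𝒜.single s a) ^ 2 :=
      p.star_mul_self' _
    rw [← h2, star_single, single_mul_single, ← hp.eq_of_le (inv_mul_le_one s)]
    refine (q.le_norm _).trans ?_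
    rw [LinearIsometry.norm_map, 𝒜.norm_adj_mul_self]
  exact le_of_sq_le_sq h1 (norm_nonneg a)

variable (𝒜)

theorem admissible_bddAbove (x : 𝒜.Cc) :
    BddAbove (Set.range fun p : {p : CStarSeminorm 𝒜.Cc // 𝒜.Admissible p} =>
      p.1.toSeminorm x) := by
  suffices h : ∃ C, ∀ p : {p : CStarSeminorm 𝒜.Cc // 𝒜.Admissible p}, p.1.toSeminorm x ≤ C by
    obtain ⟨C, hC⟩ := h
    exact ⟨C, by rintro _ ⟨p, rfl⟩; exact hC p⟩
  induction x using Cc.induction with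
  | zero => exact ⟨0, fun p => (map_zero p.1.toSeminorm).le⟩
  | single s a => exact ⟨‖a‖, fun p => p.2.single_le a⟩
  | add x y hx hy =>
    obtain ⟨C, hC⟩ := hx
    obtain ⟨D, hD⟩ := hy
    exact ⟨C + D, fun p => (map_add_le_add p.1.toSeminorm x y).trans (add_le_add (hC p) (hD p))⟩

instance : Nonempty {p : CStarSeminorm 𝒜.Cc // 𝒜.Admissible p} :=
  ⟨⟨CStarSeminorm.ofLe 0 (fun x y => by simp) (fun x => by simp), fun _ _ _ _ => rfl⟩⟩

/-- The largest admissible C*-seminorm on `C_c(𝒜)`. -/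
noncomputable def maxSeminorm : CStarSeminorm 𝒜.Cc :=
  CStarSeminorm.ofLe
    { toFun := fun x => ⨆ p : {p : CStarSeminorm 𝒜.Cc // 𝒜.Admissible p}, p.1.toSeminorm x
      map_zero' := by simp
      add_le' := fun x y => ciSup_le fun p =>
        (map_add_le_add p.1.toSeminorm x y).trans
          (add_le_add (le_ciSup (𝒜.admissible_bddAbove x) p) (le_ciSup (𝒜.admissible_bddAbove y) p))
      neg' := fun x => by simp
      smul' := fun c x => by
        simp only [map_smul_eq_mul]
        rw [Real.mul_iSup_of_nonneg (norm_nonneg c)] }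
    (fun x y => ciSup_le fun p => (p.1.mul_le' x y).trans
      (mul_le_mul (le_ciSup (𝒜.admissible_bddAbove x) p) (le_ciSup (𝒜.admissible_bddAbove y) p)
        (apply_nonneg p.1.toSeminorm y)
        (Real.iSup_nonneg fun q => apply_nonneg q.1.toSeminorm x)))
    (fun x => by
      have h0 : 0 ≤ ⨆ p : {p : CStarSeminorm 𝒜.Cc // 𝒜.Admissible p},
          p.1.toSeminorm (star x * x) := Real.iSup_nonneg fun q => apply_nonneg q.1.toSeminorm _
      have h1 : 0 ≤ ⨆ p : {p : CStarSeminorm 𝒜.Cc // 𝒜.Admissible p}, p.1.toSeminorm x :=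
        Real.iSup_nonneg fun q => apply_nonneg q.1.toSeminorm x
      refine (Real.le_sqrt h1 h0).mp ?_
      refine ciSup_le fun p => Real.le_sqrt_of_sq_le ?_
      exact (p.1.star_mul_self' x).symm.le.trans (le_ciSup (𝒜.admissible_bddAbove (star x * x)) p))

theorem le_maxSeminorm (p : CStarSeminorm 𝒜.Cc) (hp : 𝒜.Admissible p) (x : 𝒜.Cc) :
    p.toSeminorm x ≤ 𝒜.maxSeminorm.toSeminorm x :=
  le_ciSup (𝒜.admissible_bddAbove x) ⟨p, hp⟩

theorem maxSeminorm_admissible : 𝒜.Admissible 𝒜.maxSeminorm := fun s t h a =>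
  le_antisymm (ciSup_le fun p => (p.2 s t h a).le) (apply_nonneg 𝒜.maxSeminorm.toSeminorm _)

/-- The full (maximal) cross-sectional C*-algebra `C^*(𝒜)`: the enveloping C*-algebra of the
quotient of `C_c(𝒜)` by the relations `a δ_s = a δ_t`, `a ∈ A_s ⊆ A_t`, `s ≤ t`. -/
abbrev FullAlg : Type (max u v) := 𝒜.maxSeminorm.Compl

end FellBundle

/-! ### Direct sums of representations -/

section DirectSumRep

variable {ι : Type u} {G : ι → Type v} [∀ i, NormedAddCommGroup (G i)]
  [∀ i, InnerProductSpace ℂ (G i)] {B : Type w} [NonUnitalCStarAlgebra B]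

/-- A bounded family of operators acts diagonally on the Hilbert space direct sum. -/
noncomputable def lpDiag (T : ∀ i, G i →L[ℂ] G i) (C : ℝ) (hC : ∀ i, ‖T i‖ ≤ C) :
    lp G 2 →L[ℂ] lp G 2 :=
  have hb : ∀ (x : lp G 2) (i : ι), ‖T i (x i)‖ ≤ ‖(((|C| : ℝ) : ℂ) • x) i‖ := fun x i => by
    rw [lp.coeFn_smul, Pi.smul_apply, norm_smul, Complex.norm_real, Real.norm_eq_abs, abs_abs]
    exact ((T i).le_opNorm _).trans
      (mul_le_mul_of_nonneg_right ((hC i).trans (le_abs_self C)) (norm_nonneg _))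
  LinearMap.mkContinuous
    { toFun := fun x => ⟨fun i => T i (x i), (lp.memℓp (((|C| : ℝ) : ℂ) • x)).mono' (hb x)⟩
      map_add' := fun x y => by ext i; exact map_add (T i) (x i) (y i)
      map_smul' := fun c x => by ext i; exact map_smul (T i) c (x i) }
    |C| fun x => by
      refine (lp.norm_mono (y := ((|C| : ℝ) : ℂ) • x) two_ne_zero (hb x)).trans ?_
      rw [norm_smul, Complex.norm_real, Real.norm_eq_abs, abs_abs]

@[simp]
theorem lpDiag_apply (T : ∀ i, G i →L[ℂ] G i) (C : ℝ) (hC : ∀ i, ‖T i‖ ≤ C) (x : lp G 2) (i : ι) :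
    lpDiag T C hC x i = T i (x i) := rfl

variable [∀ i, CompleteSpace (G i)]

/-- The direct sum of a family of *-representations of a C*-algebra. -/
noncomputable def directSumRep (ρ : ∀ i, B →⋆ₙₐ[ℂ] (G i →L[ℂ] G i)) :
    B →⋆ₙₐ[ℂ] (lp G 2 →L[ℂ] lp G 2) where
  toFun b := lpDiag (fun i => ρ i b) ‖b‖ fun i => NonUnitalStarAlgHom.norm_apply_le (ρ i) b
  map_smul' c b := by ext x i; simp
  map_zero' := by ext x i; simp
  map_add' b c := by ext x i; simp
  map_mul' b c := by ext x i; simp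
  map_star' b := by
    refine (ContinuousLinearMap.eq_adjoint_iff _ _).mpr fun x y => ?_
    simp only [lp.inner_eq_tsum, lpDiag_apply]
    refine tsum_congr fun i => ?_
    rw [map_star, ContinuousLinearMap.star_eq_adjoint, ContinuousLinearMap.adjoint_inner_left]

end DirectSumRep

namespace FellBundle

variable {S : Type u} [InverseMonoid S] (𝒜 : FellBundle.{u, v} S)

/-- A representation of the Fell bundle `𝒜` on the Hilbert space `H`. -/
structure Rep (H : Type w) [NormedAddCommGroup H] [InnerProductSpace ℂ H] [CompleteSpace H] where
  /-- the linear maps `π_s : A_s → B(H)` -/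
  op : ∀ s : S, 𝒜.fiber s →ₗ[ℂ] (H →L[ℂ] H)
  op_mul : ∀ {s t : S} (a : 𝒜.fiber s) (b : 𝒜.fiber t), op s a * op t b = op (s * t) (𝒜.mul a b)
  op_adj : ∀ {s : S} (a : 𝒜.fiber s), star (op s a) = op s⁻¹ (𝒜.adj a)
  op_incl : ∀ {s t : S} (h : s ≤ t) (a : 𝒜.fiber s), op t (𝒜.incl h a) = op s a

open scoped ComplexOrder

noncomputable instance : PartialOrder 𝒜.FullAlg := CStarAlgebra.spectralOrder _

instance : StarOrderedRing 𝒜.FullAlg := CStarAlgebra.spectralOrderedRing _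

/-- The Hilbert space of the universal representation of `C^*(𝒜)`: the direct sum of the GNS
spaces of all positive linear functionals. -/
abbrev UnivSpace : Type (max u v) := lp (fun f : 𝒜.FullAlg →ₚ[ℂ] ℂ => f.GNS) 2

/-- The universal representation of `C^*(𝒜)`. -/
noncomputable def univHom : 𝒜.FullAlg →⋆ₙₐ[ℂ] (𝒜.UnivSpace →L[ℂ] 𝒜.UnivSpace) :=
  directSumRep fun f => f.gnsNonUnitalStarAlgHom

theorem toComplHom_incl {s t : S} (h : s ≤ t) (a : 𝒜.fiber s) :
    𝒜.maxSeminorm.toComplHom (𝒜.single t (𝒜.incl h a)) =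
      𝒜.maxSeminorm.toComplHom (𝒜.single s a) := by
  symm
  rw [← sub_eq_zero, ← map_sub, ← norm_eq_zero, CStarSeminorm.norm_toComplHom]
  exact 𝒜.maxSeminorm_admissible s t h a

/-- The universal representation of the Fell bundle `𝒜`, i.e. the restriction of the universal
representation of `C^*(𝒜)` to the fibres. -/
noncomputable def univRep : 𝒜.Rep 𝒜.UnivSpace where
  op s :=
    { toFun := fun a => 𝒜.univHom (𝒜.maxSeminorm.toComplHom (𝒜.single s a))
      map_add' := fun a b => by simp only [map_add]
      map_smul' := fun c a => by simp only [map_smul, RingHom.id_apply] }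
  op_mul a b := by
    simp only [LinearMap.coe_mk, AddHom.coe_mk]
    rw [← map_mul, ← map_mul, single_mul_single]
  op_adj a := by
    simp only [LinearMap.coe_mk, AddHom.coe_mk]
    rw [← map_star, ← map_star, star_single]
  op_incl h a := by
    simp only [LinearMap.coe_mk, AddHom.coe_mk]
    rw [toComplHom_incl]

end FellBundle

namespace FellBundle

variable {S : Type u} [InverseMonoid S] (𝒜 : FellBundle.{u, v} S)

/-! ### The ideals `I_{s,t}` and the projections `1_{s,t}` -/

/-- The closed ideal `I_{s,t}` of `A_1` generated by the `A_{v^* v}` with `v ≤ s, t`. As every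
`A_e` with `e` idempotent is an ideal of `A_1`, it is the closed linear span of the
`A_{v^* v}`. -/
noncomputable def ideal (s t : S) : Submodule ℂ (𝒜.fiber 1) :=
  (⨆ v : {v : S // v ≤ s ∧ v ≤ t},
    LinearMap.range (𝒜.incl (inv_mul_le_one v.1)).toLinearMap).topologicalClosure

variable {𝒜}

namespace Rep

variable {H : Type w} [NormedAddCommGroup H] [InnerProductSpace ℂ H] [CompleteSpace H]
  (π : 𝒜.Rep H)

/-- The restriction of a representation to the unit fibre. -/
noncomputable def unitHom : 𝒜.fiber 1 →⋆ₙₐ[ℂ] (H →L[ℂ] H) where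
  toFun := π.op 1
  map_smul' c a := map_smul (π.op 1) c a
  map_zero' := map_zero _
  map_add' := map_add _
  map_mul' a b := by rw [unit_mul_def, π.op_incl, π.op_mul]
  map_star' a := by rw [unit_star_def, π.op_incl, π.op_adj]

theorem continuous_op_one : Continuous (π.op 1) :=
  AddMonoidHomClass.continuous_of_bound π.unitHom 1 fun a => by
    rw [one_mul]
    exact NonUnitalStarAlgHom.norm_apply_le π.unitHom a

theorem op_op_apply {s t : S} (a : 𝒜.fiber s) (b : 𝒜.fiber t) (x : H) :
    π.op s a (π.op t b x) = π.op (s * t) (𝒜.mul a b) x := by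
  rw [← π.op_mul]
  rfl

/-- The closed linear span of `π(I_{s,t}) H`. -/
def unitSpace (s t : S) : Submodule ℂ H :=
  (Submodule.span ℂ {y : H | ∃ a ∈ 𝒜.ideal s t, ∃ h : H, π.op 1 a h = y}).topologicalClosure

instance (s t : S) : CompleteSpace (π.unitSpace s t) :=
  inferInstanceAs (CompleteSpace (Submodule.topologicalClosure _))

/-- The projection `1_{s,t}`: the unit of the weak closure `I_{s,t}''` of `π(I_{s,t})`, that is,
the orthogonal projection onto the closed linear span of `π(I_{s,t}) H`. -/
noncomputable def unitProj (s t : S) : H →L[ℂ] H := (π.unitSpace s t).starProjection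

/-- The projection `1_s = 1_{s,1}`. -/
noncomputable def one (s : S) : H →L[ℂ] H := π.unitProj s 1

theorem isClosed_unitSpace (s t : S) : IsClosed (π.unitSpace s t : Set H) :=
  Submodule.isClosed_topologicalClosure _

theorem mem_unitSpace {e s : S} (he : e * e = e) (h : e ≤ s) (a : 𝒜.fiber e) (x : H) :
    π.op e a x ∈ π.unitSpace s 1 := by
  have h1 : e ≤ e⁻¹ * e := le_of_eq' (by rw [inv_of_idem he, he])
  refine Submodule.le_topologicalClosure _ (Submodule.subset_span ?_)
  refine ⟨𝒜.incl (idem_le_one he) a, ?_, x, by rw [π.op_incl]⟩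
  refine Submodule.le_topologicalClosure _ ?_
  refine Submodule.mem_iSup_of_mem ⟨e, h, idem_le_one he⟩ ⟨𝒜.incl h1 a, ?_⟩
  exact 𝒜.incl_trans h1 _ _ a

theorem unitSpace_le {s : S} {M : Submodule ℂ H} (hM : IsClosed (M : Set H))
    (h : ∀ e : S, e * e = e → e ≤ s → ∀ (a : 𝒜.fiber e) (x : H), π.op e a x ∈ M) :
    π.unitSpace s 1 ≤ M := by
  refine Submodule.topologicalClosure_minimal _ (Submodule.span_le.mpr ?_) hM
  rintro _ ⟨a, ha, x, rfl⟩
  let L : 𝒜.fiber 1 →ₗ[ℂ] H := (ContinuousLinearMap.apply ℂ H x).toLinearMap ∘ₗ π.op 1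
  have hL : Continuous L :=
    (ContinuousLinearMap.apply ℂ H x).continuous.comp π.continuous_op_one
  suffices h' : 𝒜.ideal s 1 ≤ M.comap L from h' ha
  refine Submodule.topologicalClosure_minimal _ (iSup_le ?_) (hM.preimage hL)
  rintro ⟨v, hv, hv1⟩ _ ⟨b, rfl⟩
  have hvv : v⁻¹ * v = v := by
    rw [inv_of_idem (idem_of_le_one hv1), idem_of_le_one hv1]
  change π.op 1 (𝒜.incl (inv_mul_le_one v) b) x ∈ M
  rw [π.op_incl]
  exact h _ (idem_inv_mul v) (le_trans' (le_of_eq' hvv) hv) b x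

theorem map_unitSpace {s : S} {M : Submodule ℂ H} (hM : IsClosed (M : Set H)) (T : H →L[ℂ] H)
    (h : ∀ e : S, e * e = e → e ≤ s → ∀ (a : 𝒜.fiber e) (x : H), T (π.op e a x) ∈ M)
    {x : H} (hx : x ∈ π.unitSpace s 1) : T x ∈ M := by
  have h' : π.unitSpace s 1 ≤ M.comap T.toLinearMap :=
    π.unitSpace_le (hM.preimage T.continuous) h
  exact h' hx

theorem unitSpace_mono {s t : S} (h : s ≤ t) : π.unitSpace s 1 ≤ π.unitSpace t 1 :=
  π.unitSpace_le (π.isClosed_unitSpace t 1) fun _ he hes a x =>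
    π.mem_unitSpace he (le_trans' hes h) a x

/-- The range of `π_r(c)` lies in every closed subspace that contains `π(A_{r r^*}) H`. -/
theorem range_mem {r : S} {M : Submodule ℂ H} (hM : IsClosed (M : Set H))
    (h : ∀ (b : 𝒜.fiber (r * r⁻¹)) (x : H), π.op (r * r⁻¹) b x ∈ M) (c : 𝒜.fiber r) (x : H) :
    π.op r c x ∈ M := by
  have : CompleteSpace M := hM.completeSpace_coe
  rw [← Submodule.orthogonal_orthogonal M, Submodule.mem_orthogonal]
  intro y hy
  have h1 : star (π.op r c) y = 0 := by
    rw [← inner_self_eq_zero (𝕜 := ℂ)]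
    nth_rewrite 1 [ContinuousLinearMap.star_eq_adjoint]
    rw [ContinuousLinearMap.adjoint_inner_left, π.op_adj, π.op_op_apply]
    exact inner_eq_zero_symm.mp (Submodule.mem_orthogonal M y |>.mp hy _ (h _ y))
  rw [← ContinuousLinearMap.adjoint_inner_left, ← ContinuousLinearMap.star_eq_adjoint, h1,
    inner_zero_left]

theorem op_mem_unitSpace {r u : S} (h : r * r⁻¹ ≤ u) (c : 𝒜.fiber r) (x : H) :
    π.op r c x ∈ π.unitSpace u 1 :=
  π.range_mem (π.isClosed_unitSpace u 1)
    (fun b y => π.mem_unitSpace (idem_mul_inv r) h b y) c x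

theorem one_isSymmetric (u : S) (x y : H) :
    inner ℂ (π.one u x) y = inner ℂ x (π.one u y) :=
  Submodule.inner_starProjection_left_eq_right _ x y

theorem star_one (u : S) : star (π.one u) = π.one u := by
  rw [ContinuousLinearMap.star_eq_adjoint]
  exact ((ContinuousLinearMap.eq_adjoint_iff _ _).mpr (π.one_isSymmetric u)).symm

theorem one_apply_mem (u : S) (x : H) : π.one u x ∈ π.unitSpace u 1 :=
  Submodule.starProjection_apply_mem _ x

theorem one_apply_eq {u : S} {x : H} (h : x ∈ π.unitSpace u 1) : π.one u x = x :=
  Submodule.starProjection_eq_self_iff.mpr h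

theorem one_mul_one (u : S) : π.one u * π.one u = π.one u := by
  ext x
  exact π.one_apply_eq (π.one_apply_mem u x)

theorem intertwine {T : H →L[ℂ] H} {u w : S}
    (h₁ : ∀ x ∈ π.unitSpace u 1, T x ∈ π.unitSpace w 1)
    (h₂ : ∀ x ∈ π.unitSpace w 1, star T x ∈ π.unitSpace u 1) : T * π.one u = π.one w * T := by
  have e1 : π.one w * (T * π.one u) = T * π.one u := by
    ext x
    exact π.one_apply_eq (h₁ _ (π.one_apply_mem u x))
  have e2 : π.one u * (star T * π.one w) = star T * π.one w := by
    ext x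
    exact π.one_apply_eq (h₂ _ (π.one_apply_mem w x))
  have e3 := congrArg star e2
  simp only [star_mul, star_star, star_one] at e3
  rw [← e1, ← e3, ← mul_assoc]

theorem op_map_unitSpace {s u w : S} (a : 𝒜.fiber s)
    (h : ∀ e : S, e * e = e → e ≤ u → s * e * s⁻¹ ≤ w) (x : H) (hx : x ∈ π.unitSpace u 1) :
    π.op s a x ∈ π.unitSpace w 1 := by
  refine π.map_unitSpace (π.isClosed_unitSpace w 1) _ (fun e he heu b y => ?_) hx
  rw [op_op_apply]
  refine π.op_mem_unitSpace (le_trans' (le_of_eq' ?_) (h e he heu)) _ y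
  rw [mul_inv_rev', inv_of_idem he]
  calc s * e * (e * s⁻¹) = s * (e * e) * s⁻¹ := by simp only [mul_assoc]
    _ = s * e * s⁻¹ := by rw [he]

theorem op_mul_one_eq {s u w : S} (a : 𝒜.fiber s)
    (h₁ : ∀ e : S, e * e = e → e ≤ u → s * e * s⁻¹ ≤ w)
    (h₂ : ∀ e : S, e * e = e → e ≤ w → s⁻¹ * e * s ≤ u) :
    π.op s a * π.one u = π.one w * π.op s a := by
  refine π.intertwine (π.op_map_unitSpace a h₁) ?_
  rw [π.op_adj]
  refine π.op_map_unitSpace _ ?_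
  simpa only [inv_inv'] using h₂

theorem op_mul_one_conj {s : S} (a : 𝒜.fiber s) (u : S) :
    π.op s a * π.one u = π.one (s * u * s⁻¹) * π.op s a := by
  refine π.op_mul_one_eq a (fun e _ heu => ?_) (fun e _ hew => ?_)
  · exact mul_le_mul'' (mul_le_mul'' (le_refl' s) heu) (le_refl' _)
  · have h1 : s⁻¹ * e * s ≤ s⁻¹ * (s * u * s⁻¹) * s :=
      mul_le_mul'' (mul_le_mul'' (le_refl' _) hew) (le_refl' _)
    have h2 : s⁻¹ * (s * u * s⁻¹) * s = (s⁻¹ * s) * u * (s⁻¹ * s) := by simp only [mul_assoc]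
    rw [h2] at h1
    exact le_trans' h1 (le_trans' (mul_idem_le _ (idem_inv_mul s))
      (idem_mul_le (idem_inv_mul s) u))

theorem op_mul_one_swap {t : S} (a : 𝒜.fiber t) (s : S) :
    π.op t a * π.one (s⁻¹ * t) = π.one (s * t⁻¹) * π.op t a := by
  refine π.op_mul_one_eq a (fun e he hes => ?_) (fun e he hes => ?_)
  · have h1 := le_inv_of_idem_le he hes
    rw [mul_inv_rev', inv_inv'] at h1
    have h2 : t * e * t⁻¹ ≤ t * (t⁻¹ * s) * t⁻¹ :=
      mul_le_mul'' (mul_le_mul'' (le_refl' _) h1) (le_refl' _)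
    have h3 : t * (t⁻¹ * s) * t⁻¹ = (t * t⁻¹) * (s * t⁻¹) := by simp only [mul_assoc]
    rw [h3] at h2
    exact le_trans' h2 (idem_mul_le (idem_mul_inv t) _)
  · have h1 := le_inv_of_idem_le he hes
    rw [mul_inv_rev', inv_inv'] at h1
    have h2 : t⁻¹ * e * t ≤ t⁻¹ * (t * s⁻¹) * t :=
      mul_le_mul'' (mul_le_mul'' (le_refl' _) h1) (le_refl' _)
    have h3 : t⁻¹ * (t * s⁻¹) * t = (t⁻¹ * t) * (s⁻¹ * t) := by simp only [mul_assoc]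
    rw [h3] at h2
    exact le_trans' h2 (idem_mul_le (idem_inv_mul t) _)

theorem op_idem_comm_one {e : S} (he : e * e = e) (b : 𝒜.fiber e) (u : S) :
    π.op e b * π.one u = π.one u * π.op e b := by
  have key : ∀ f : S, f * f = f → f ≤ u → e * f * e ≤ u := fun f hf hfu =>
    le_trans' (le_trans' (mul_idem_le _ he) (idem_mul_le he f)) hfu
  refine π.op_mul_one_eq b (fun f hf hfu => ?_) (fun f hf hfu => ?_)
  · rw [inv_of_idem he]; exact key f hf hfu
  · rw [inv_of_idem he]; exact key f hf hfu

theorem one_op_apply {e : S} (he : e * e = e) (b : 𝒜.fiber e) (u : S) (x : H) :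
    π.one u (π.op e b x) = π.op e b (π.one u x) :=
  (DFunLike.congr_fun (π.op_idem_comm_one he b u) x).symm

theorem one_map_unitSpace (u w : S) (x : H) (hx : x ∈ π.unitSpace u 1) :
    π.one w x ∈ π.unitSpace u 1 := by
  refine π.map_unitSpace (π.isClosed_unitSpace u 1) _ (fun e he heu b y => ?_) hx
  rw [π.one_op_apply he]
  exact π.mem_unitSpace he heu b _

theorem one_comm (u w : S) : π.one u * π.one w = π.one w * π.one u := by
  symm
  refine π.intertwine (π.one_map_unitSpace u w) ?_
  rw [star_one]
  exact π.one_map_unitSpace u w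

theorem one_inv (u : S) : π.one u⁻¹ = π.one u := by
  have key : ∀ s : S, π.unitSpace s 1 ≤ π.unitSpace s⁻¹ 1 := fun s =>
    π.unitSpace_le (π.isClosed_unitSpace s⁻¹ 1) fun e he hes b y =>
      π.mem_unitSpace he (le_inv_of_idem_le he hes) b y
  have : π.unitSpace u⁻¹ 1 = π.unitSpace u 1 :=
    le_antisymm (by simpa only [inv_inv'] using key u⁻¹) (key u)
  simp only [one, unitProj, this]

theorem one_mul_one_mem (u w : S) (x : H) : π.one u (π.one w x) ∈ π.unitSpace (u * w) 1 := by
  refine π.map_unitSpace (π.isClosed_unitSpace (u * w) 1) _ (fun f hf hfw b y => ?_)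
    (π.one_apply_mem w x)
  rw [π.one_op_apply hf]
  refine π.map_unitSpace (π.isClosed_unitSpace (u * w) 1) _ (fun e he heu c z => ?_)
    (π.one_apply_mem u y)
  rw [op_op_apply]
  refine π.mem_unitSpace (idem_mul hf he) ?_ _ z
  rw [idem_comm hf he]
  exact mul_le_mul'' heu hfw

theorem one_mul_eq_of_le {u w : S} (h : u ≤ w) : π.one w * π.one u = π.one u := by
  ext x
  exact π.one_apply_eq (π.unitSpace_mono h (π.one_apply_mem u x))

/-- The projections `1_{s t^*}`. -/
noncomputable def link (s t : S) : H →L[ℂ] H := π.one (s * t⁻¹)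

theorem link_symm (s t : S) : π.link s t = π.link t s := by
  rw [link, ← π.one_inv, mul_inv_rev', inv_inv', link]

theorem link_trans (r s t : S) :
    π.link r t * (π.link r s * π.link s t) = π.link r s * π.link s t := by
  ext x
  refine π.one_apply_eq (π.unitSpace_mono ?_ (π.one_mul_one_mem _ _ x))
  have h : r * s⁻¹ * (s * t⁻¹) = r * (s⁻¹ * s) * t⁻¹ := by simp only [mul_assoc]
  rw [h]
  exact mul_le_mul'' (mul_idem_le r (idem_inv_mul s)) (le_refl' _)

end Rep

end FellBundle

/-! ### A positivity lemma -/

theorem re_sum_inner_nonneg {ι : Type u} {H : Type w} [NormedAddCommGroup H]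
    [InnerProductSpace ℂ H] (q : ι → ι → (H →L[ℂ] H)) (D : H →L[ℂ] H)
    (hsa : ∀ i j x y, inner ℂ (q i j x) y = inner ℂ x (q i j y))
    (hsymm : ∀ i j, q i j = q j i) (hidem : ∀ i j, q i j * q i j = q i j)
    (hcomm : ∀ i j k l, q i j * q k l = q k l * q i j)
    (htrans : ∀ i j k, q i k * (q i j * q j k) = q i j * q j k)
    (hD : ∀ i j, D * q i j = q i j * D) (hpos : ∀ x, 0 ≤ (inner ℂ x (D x)).re)
    (F : Finset ι) (x : ι → H) :
    0 ≤ (∑ i ∈ F, ∑ j ∈ F, inner ℂ (x i) (D (q i j (x j)))).re := by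
  classical
  induction F using Finset.induction generalizing x with
  | empty => simp
  | insert a F ha ih =>
    let x' : ι → H := fun j => x j - q a j (x j)
    have hop : ∀ i j, q i j = q i a * q a j + (1 - q i a) * (q i j * (1 - q a j)) := fun i j => by
      have e1 : q i a * q i j = q i a * q a j * q i j := by
        have h := htrans a i j
        rw [hsymm a i] at h
        rw [← h, ← mul_assoc, hcomm a j i a]
      have e2 : q i a * q a j * q i j = q i a * q a j := by
        have h := htrans i a j
        rw [mul_assoc, hcomm a j i j, ← mul_assoc, hcomm i a i j, mul_assoc]
        exact h
      have e3 : q i j * q a j = q i a * q a j * q i j := by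
        have h := htrans i j a
        rw [hsymm j a] at h
        rw [← h, mul_assoc, hcomm i j a j]
      have e4 : q i a * (q i j * q a j) = q i a * q a j := by
        rw [e3, e2, ← mul_assoc, hidem]
      rw [mul_sub, mul_one, mul_sub, sub_mul, sub_mul, one_mul, one_mul, e4, e1, e3, e2]
      abel
    have hterm : ∀ i j, inner ℂ (x i) (D (q i j (x j))) =
        inner ℂ (q a i (x i)) (D (q a j (x j))) + inner ℂ (x' i) (D (q i j (x' j))) := fun i j => by
      have hc : ∀ y, D (q i a y) = q i a (D y) := fun y => DFunLike.congr_fun (hD i a) y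
      have h1 : q i j (x j) = q i a (q a j (x j)) +
          (q i j (x' j) - q i a (q i j (x' j))) := by
        conv_lhs => rw [hop i j]
        simp [x']
      rw [h1, map_add, map_sub, hc, hc, inner_add_right, inner_sub_right, ← hsa, ← hsa,
        hsymm i a, ← inner_sub_left]
    have hzl : ∀ j, q a j (x' j) = 0 := fun j => by
      have := DFunLike.congr_fun (hidem a j) (x j)
      simp only [x', map_sub]
      exact sub_eq_zero.mpr this.symm
    have haa : ∀ i, q i a * q a a = q i a := fun i => by
      have h := htrans a i a
      rw [hsymm a i, hidem] at h
      rw [hcomm]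
      exact h
    have hzr : ∀ i, q i a (x' a) = 0 := fun i => by
      have := DFunLike.congr_fun (haa i) (x a)
      simp only [x', map_sub]
      exact sub_eq_zero.mpr this.symm
    have hsum : ∑ i ∈ insert a F, ∑ j ∈ insert a F, inner ℂ (x i) (D (q i j (x j))) =
        inner ℂ (∑ i ∈ insert a F, q a i (x i)) (D (∑ j ∈ insert a F, q a j (x j))) +
          ∑ i ∈ F, ∑ j ∈ F, inner ℂ (x' i) (D (q i j (x' j))) := by
      rw [map_sum, sum_inner]
      simp only [inner_sum, hterm, Finset.sum_add_distrib]
      congr 1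
      rw [Finset.sum_insert ha]
      simp only [hzl, map_zero, inner_zero_right, Finset.sum_const_zero, zero_add]
      refine Finset.sum_congr rfl fun i _ => ?_
      rw [Finset.sum_insert ha, hzr, map_zero, inner_zero_right, zero_add]
    rw [hsum, Complex.add_re]
    exact add_nonneg (hpos _) (ih x')

namespace FellBundle.Rep

variable {S : Type u} [InverseMonoid S] {𝒜 : FellBundle.{u, v} S}
  {H : Type w} [NormedAddCommGroup H] [InnerProductSpace ℂ H] [CompleteSpace H]
  (π : 𝒜.Rep H)

theorem link_apply (s t : S) (h : H) : π.link s t h = π.one (s * t⁻¹) h := rfl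

theorem link_pos (D : H →L[ℂ] H) (hD : ∀ u, D * π.one u = π.one u * D)
    (hpos : ∀ x, 0 ≤ (inner ℂ x (D x)).re) (F : Finset S) (x : S → H) :
    0 ≤ (∑ i ∈ F, ∑ j ∈ F, inner ℂ (x i) (D (π.link i j (x j)))).re :=
  re_sum_inner_nonneg π.link D (fun _ _ => π.one_isSymmetric _) π.link_symm
    (fun _ _ => π.one_mul_one _) (fun _ _ _ _ => π.one_comm _ _) π.link_trans
    (fun _ _ => hD _) hpos F x

/-! ### Weak closures of the fibres -/

/-- The identity map from bounded operators to bounded operators with the weak operator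
topology. -/
noncomputable def toWOT : (H →L[ℂ] H) →ₗ[ℂ] (H →WOT[ℂ] H) :=
  (ContinuousLinearMapWOT.linearEquiv (σ := RingHom.id ℂ) (E := H) (F := H) ℂ).symm.toLinearMap

/-- The closure of `π(A_s)` in the weak operator topology. For the universal representation this is
the bidual `A_s''`. -/
noncomputable def vnFiber (s : S) : Submodule ℂ (H →L[ℂ] H) :=
  ((LinearMap.range (π.op s)).map toWOT).topologicalClosure.comap toWOT

theorem vnFiber_le {s : S} {M : Submodule ℂ (H →WOT[ℂ] H)} (hM : IsClosed (M : Set (H →WOT[ℂ] H)))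
    (h : ∀ a, toWOT (π.op s a) ∈ M) {y : H →L[ℂ] H} (hy : y ∈ π.vnFiber s) : toWOT y ∈ M := by
  refine Submodule.topologicalClosure_minimal _ ?_ hM hy
  rintro _ ⟨_, ⟨a, rfl⟩, rfl⟩
  exact h a

theorem vnFiber_intertwine {s : S} (Q R : H →L[ℂ] H) (h : ∀ a, π.op s a * Q = R * π.op s a)
    {y : H →L[ℂ] H} (hy : y ∈ π.vnFiber s) : y * Q = R * y := by
  let M : Submodule ℂ (H →WOT[ℂ] H) :=
    LinearMap.eqLocus
      (ContinuousLinearMapWOT.precompCLM (σ₂₃ := RingHom.id ℂ) (toWOT Q)).toLinearMap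
      (ContinuousLinearMapWOT.postcompCLM (σ₁₂ := RingHom.id ℂ) (toWOT R)).toLinearMap
  have hM : IsClosed (M : Set (H →WOT[ℂ] H)) :=
    isClosed_eq (ContinuousLinearMap.continuous _) (ContinuousLinearMap.continuous _)
  have := π.vnFiber_le hM (fun a => congrArg toWOT (h a)) hy
  exact ContinuousLinearMapWOT.ofCLM_injective this

theorem op_mul_mem_vnFiber {s t : S} (a : 𝒜.fiber s) {y : H →L[ℂ] H} (hy : y ∈ π.vnFiber t) :
    π.op s a * y ∈ π.vnFiber (s * t) := by
  let N := ((LinearMap.range (π.op (s * t))).map (toWOT (H := H))).topologicalClosure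
  let M : Submodule ℂ (H →WOT[ℂ] H) := 
    N.comap (ContinuousLinearMapWOT.postcompCLM (σ₁₂ := RingHom.id ℂ) (toWOT (π.op s a))).toLinearMap
  have hM : IsClosed (M : Set (H →WOT[ℂ] H)) :=
    (Submodule.isClosed_topologicalClosure _).preimage (ContinuousLinearMap.continuous _)
  refine π.vnFiber_le hM (fun b => ?_) hy
  change toWOT (π.op s a * π.op t b) ∈ N
  rw [π.op_mul]
  exact Submodule.le_topologicalClosure _ ⟨_, ⟨_, rfl⟩, rfl⟩

theorem vnFiber_swap {t : S} {y : H →L[ℂ] H} (hy : y ∈ π.vnFiber t) (s : S) (x : H) :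
    y (π.one (s⁻¹ * t) x) = π.one (s * t⁻¹) (y x) :=
  DFunLike.congr_fun (π.vnFiber_intertwine _ _ (fun a => π.op_mul_one_swap a s) hy) x

theorem vnFiber_apply_mem {t : S} {y : H →L[ℂ] H} (hy : y ∈ π.vnFiber t) (x : H) :
    y x ∈ π.unitSpace (t * t⁻¹) 1 := by
  have h := π.vnFiber_intertwine (s := t) 1 (π.one (t * t⁻¹)) (fun a => ?_) hy
  · have := DFunLike.congr_fun h x
    rw [show y x = π.one (t * t⁻¹) (y x) from this]
    exact π.one_apply_mem _ _
  · rw [mul_one]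
    ext z
    exact (π.one_apply_eq (π.op_mem_unitSpace (le_refl' _) a z)).symm

/-! ### An auxiliary space -/

/-- The positive semidefinite form `⟪x, y⟫ = ∑_{s,t} ⟪x s, 1_{s t^*} (y t)⟫` on the finitely
supported functions `S → H`. -/
@[reducible]
noncomputable def auxCore : PreInnerProductSpace.Core ℂ (S →₀ H) where
  inner x y := x.sum fun s h => y.sum fun t k => inner ℂ h (π.link s t k)
  conj_inner_symm x y := by
    simp only [Finsupp.sum, map_sum, inner_conj_symm]
    rw [Finset.sum_comm]
    refine Finset.sum_congr rfl fun s _ => Finset.sum_congr rfl fun t _ => ?_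
    rw [π.link_symm s t]
    exact π.one_isSymmetric _ _ _
  re_inner_nonneg x :=
    π.link_pos 1 (fun u => by rw [one_mul, mul_one])
      (fun x => inner_self_nonneg (𝕜 := ℂ) (x := x)) x.support x
  add_left x y z := by
    refine Finsupp.sum_add_index' (fun s => ?_) (fun s h k => ?_)
    · simp [Finsupp.sum]
    · simp only [Finsupp.sum, inner_add_left, Finset.sum_add_distrib]
  smul_left x y r := by
    have h := Finsupp.sum_smul_index' (g := x) (b := r)
      (h := fun s h => y.sum fun t k => inner ℂ h (π.link s t k))
      (fun s => by simp [Finsupp.sum])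
    refine h.trans ?_
    simp only [Finsupp.sum, Finset.mul_sum, inner_smul_left]

set_option linter.unusedVariables false in
/-- The finitely supported functions `S → H` with the form `auxCore`. -/
def Aux (π : 𝒜.Rep H) : Type (max u w) := S →₀ H

noncomputable instance : SeminormedAddCommGroup π.Aux :=
  @InnerProductSpace.Core.toSeminormedAddCommGroup ℂ (S →₀ H) _ _ _ π.auxCore

noncomputable instance : InnerProductSpace ℂ π.Aux :=
  InnerProductSpace.ofCore (F := S →₀ H) π.auxCore

/-- The identity map onto the auxiliary space. -/
noncomputable def toAux : (S →₀ H) ≃ₗ[ℂ] π.Aux where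
  toFun x := x
  invFun x := x
  map_add' _ _ := rfl
  map_smul' _ _ := rfl
  left_inv _ := rfl
  right_inv _ := rfl

/-- The function with value `h` at `s` and zero elsewhere. -/
noncomputable def auxSingle (s : S) : H →ₗ[ℂ] π.Aux := π.toAux.toLinearMap ∘ₗ Finsupp.lsingle s

theorem inner_auxSingle (s t : S) (h k : H) :
    inner ℂ (π.auxSingle s h) (π.auxSingle t k) = inner ℂ h (π.link s t k) := by
  change Finsupp.sum (Finsupp.single s h) (fun s h => Finsupp.sum (Finsupp.single t k)
    fun t k => inner ℂ h (π.link s t k)) = _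
  rw [Finsupp.sum_single_index (by simp [Finsupp.sum]), Finsupp.sum_single_index (by simp)]

theorem aux_eq_sum (x : π.Aux) :
    ∃ (F : Finset S) (y : S → H), x = ∑ s ∈ F, π.auxSingle s (y s) := by
  let y : S →₀ H := π.toAux.symm x
  refine ⟨y.support, y, ?_⟩
  have h : ∑ s ∈ y.support, Finsupp.single s (y s) = y := Finsupp.sum_single y
  have h2 := congrArg π.toAux h
  rw [map_sum] at h2
  exact h2.symm

/-- `a δ_s` acts on the auxiliary space by `h δ_t ↦ π_s(a) h δ_{st}`. -/
noncomputable def auxActHom (s : S) : 𝒜.fiber s →ₗ[ℂ] (π.Aux →ₗ[ℂ] π.Aux) :=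
  LinearMap.flip <| (Finsupp.lsum ℂ fun t =>
    ((ContinuousLinearMap.coeLM ℂ ∘ₗ π.op s).compr₂ (π.auxSingle (s * t))).flip) ∘ₗ
      π.toAux.symm.toLinearMap

theorem auxActHom_single {s t : S} (a : 𝒜.fiber s) (h : H) :
    π.auxActHom s a (π.auxSingle t h) = π.auxSingle (s * t) (π.op s a h) := by
  simp [auxActHom, auxSingle]

/-- The action of `C_c(𝒜)` on the auxiliary space. -/
noncomputable def auxAct : 𝒜.Cc →ₗ[ℂ] (π.Aux →ₗ[ℂ] π.Aux) := 𝒜.lift π.auxActHom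

theorem auxAct_single {s t : S} (a : 𝒜.fiber s) (h : H) :
    π.auxAct (𝒜.single s a) (π.auxSingle t h) = π.auxSingle (s * t) (π.op s a h) := by
  rw [auxAct, lift_single, auxActHom_single]

theorem norm_auxAct_le {s : S} (a : 𝒜.fiber s) (x : π.Aux) :
    ‖π.auxAct (𝒜.single s a) x‖ ≤ ‖π.op s a‖ * ‖x‖ := by
  obtain ⟨F, y, rfl⟩ := π.aux_eq_sum x
  set T := π.op s a with hT
  have hconj : ∀ u, T * π.one u = π.one (s * u * s⁻¹) * T := fun u => π.op_mul_one_conj a u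
  let D : H →L[ℂ] H := ((‖T‖ ^ 2 : ℝ) : ℂ) • 1 - star T * T
  have hTT : ∀ u, star T * T * π.one u = π.one u * (star T * T) := fun u => by
    have h := congrArg star (hconj u)
    rw [star_mul, star_mul, star_one, star_one] at h
    rw [mul_assoc, hconj, ← mul_assoc, ← h, mul_assoc]
  have hD : ∀ u, D * π.one u = π.one u * D := fun u => by
    simp only [D, sub_mul, mul_sub, hTT, smul_mul_assoc, mul_smul_comm, one_mul, mul_one]
  have hin : ∀ h k, inner ℂ h (D k) = ((‖T‖ ^ 2 : ℝ) : ℂ) * inner ℂ h k - inner ℂ (T h) (T k) :=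
    fun h k => by
      rw [← ContinuousLinearMap.adjoint_inner_right, ← ContinuousLinearMap.star_eq_adjoint]
      simp [D]
  have hpos : ∀ h, 0 ≤ (inner ℂ h (D h)).re := fun h => by
    rw [hin, inner_self_eq_norm_sq_to_K, inner_self_eq_norm_sq_to_K]
    have h1 : ‖T h‖ ^ 2 ≤ ‖T‖ ^ 2 * ‖h‖ ^ 2 := by
      rw [← mul_pow]
      exact pow_le_pow_left₀ (norm_nonneg _) (T.le_opNorm h) 2
    have h2 : (((‖T‖ ^ 2 : ℝ) : ℂ) * (‖h‖ : ℂ) ^ 2 - (‖T h‖ : ℂ) ^ 2).re =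
        ‖T‖ ^ 2 * ‖h‖ ^ 2 - ‖T h‖ ^ 2 := by
      norm_cast
    exact (sub_nonneg.mpr h1).trans_eq h2.symm
  have key := π.link_pos D hD hpos F y
  have hlink : ∀ i j h, π.link (s * i) (s * j) (T h) = T (π.link i j h) := fun i j h => by
    have := DFunLike.congr_fun (hconj (i * j⁻¹)) h
    have h2 : s * i * (s * j)⁻¹ = s * (i * j⁻¹) * s⁻¹ := by
      rw [mul_inv_rev']; simp only [mul_assoc]
    rw [link, h2]
    exact this.symm
  have e1 : (inner ℂ (∑ i ∈ F, π.auxSingle i (y i)) (∑ i ∈ F, π.auxSingle i (y i))) =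
      ∑ i ∈ F, ∑ j ∈ F, inner ℂ (y i) (π.link i j (y j)) := by
    rw [sum_inner]
    simp only [inner_sum, inner_auxSingle]
  have e2 : (inner ℂ (π.auxAct (𝒜.single s a) (∑ i ∈ F, π.auxSingle i (y i)))
      (π.auxAct (𝒜.single s a) (∑ i ∈ F, π.auxSingle i (y i)))) =
      ∑ i ∈ F, ∑ j ∈ F, inner ℂ (T (y i)) (T (π.link i j (y j))) := by
    simp only [map_sum, auxAct_single]
    rw [sum_inner]
    simp only [inner_sum, inner_auxSingle]
    exact Finset.sum_congr rfl fun i _ => Finset.sum_congr rfl fun j _ => by rw [hlink]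
  refine le_of_sq_le_sq ?_ (by positivity)
  rw [mul_pow, norm_sq_eq_re_inner (𝕜 := ℂ), norm_sq_eq_re_inner (𝕜 := ℂ) (∑ i ∈ F, _), e1, e2]
  simp only [hin, Finset.sum_sub_distrib, ← Finset.mul_sum] at key
  rw [Complex.sub_re, Complex.re_ofReal_mul] at key
  exact sub_nonneg.mp key

theorem auxAct_adjoint (x : 𝒜.Cc) (k l : π.Aux) :
    inner ℂ (π.auxAct x k) l = inner ℂ k (π.auxAct (star x) l) := by
  induction x using Cc.induction with
  | zero => simp
  | add x y hx hy => simp only [map_add, star_add, LinearMap.add_apply, inner_add_left,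
      inner_add_right, hx, hy]
  | single s a =>
    obtain ⟨F, y, rfl⟩ := π.aux_eq_sum k
    obtain ⟨G, z, rfl⟩ := π.aux_eq_sum l
    rw [star_single]
    simp only [map_sum, auxAct_single, sum_inner, inner_sum, inner_auxSingle]
    refine Finset.sum_congr rfl fun r _ => Finset.sum_congr rfl fun t _ => ?_
    rw [← π.op_adj, ContinuousLinearMap.star_eq_adjoint]
    have h : π.op s a * π.link t (s⁻¹ * r) = π.link (s * t) r * π.op s a := by
      refine π.op_mul_one_eq a (fun e _ hes => ?_) (fun e _ hes => ?_)
      · have h2 : s * e * s⁻¹ ≤ s * (t * (s⁻¹ * r)⁻¹) * s⁻¹ :=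
          mul_le_mul'' (mul_le_mul'' (le_refl' _) hes) (le_refl' _)
        have h3 : s * (t * (s⁻¹ * r)⁻¹) * s⁻¹ = (s * t * r⁻¹) * (s * s⁻¹) := by
          rw [mul_inv_rev', inv_inv']; simp only [mul_assoc]
        rw [h3] at h2
        exact le_trans' h2 (mul_idem_le _ (idem_mul_inv s))
      · have h2 : s⁻¹ * e * s ≤ s⁻¹ * (s * t * r⁻¹) * s :=
          mul_le_mul'' (mul_le_mul'' (le_refl' _) hes) (le_refl' _)
        have h3 : s⁻¹ * (s * t * r⁻¹) * s = (s⁻¹ * s) * (t * (s⁻¹ * r)⁻¹) := by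
          rw [mul_inv_rev', inv_inv']; simp only [mul_assoc]
        rw [h3] at h2
        exact le_trans' h2 (idem_mul_le (idem_inv_mul s) _)
    have h' : π.op s a (π.link t (s⁻¹ * r) (y t)) = π.link (s * t) r (π.op s a (y t)) :=
      DFunLike.congr_fun h (y t)
    rw [link_apply π (s * t), ← π.one_isSymmetric, link_apply π t, ← π.one_isSymmetric,
      ContinuousLinearMap.adjoint_inner_right]
    exact congrArg (fun v => inner ℂ v (z r)) h'.symm

end FellBundle.Rep

namespace FellBundle.Rep

variable {S : Type u} [InverseMonoid S] {𝒜 : FellBundle.{u, v} S}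
  {H : Type w} [NormedAddCommGroup H] [InnerProductSpace ℂ H] [CompleteSpace H]
  (π : 𝒜.Rep H)

/-! ### The Hilbert module `ℓ²(𝒜'')` -/

/-- The space `C_c(𝒜'')` of finitely supported sections of the fibres `A_s''`. -/
def ccVN : Submodule ℂ (S →₀ (H →L[ℂ] H)) where
  carrier := {f | ∀ s, f s ∈ π.vnFiber s}
  zero_mem' _ := Submodule.zero_mem _
  add_mem' hf hg s := Submodule.add_mem _ (hf s) (hg s)
  smul_mem' c _ hf s := Submodule.smul_mem _ c (hf s)

/-- The weak conditional expectation `P''(x δ_s) = x 1_s`, with values in `A_1''`. (All `A_s''` are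
regarded as subspaces of `B(H)`, so that `A_v''` is contained in `A_s''` for `v ≤ s` and the
isomorphism from `A_s'' 1_s` onto `A_1'' 1_s` is the identity.) -/
noncomputable def condExp : (S →₀ (H →L[ℂ] H)) →ₗ[ℂ] (H →L[ℂ] H) :=
  Finsupp.lsum ℂ fun s => LinearMap.mulRight ℂ (π.one s)

/-- The inner product `⟨f, g⟩ = P''(f^* g)`, where `(x δ_s)^* (y δ_t) = x^* y δ_{s^* t}`. -/
noncomputable def vnInner (f g : S →₀ (H →L[ℂ] H)) : H →L[ℂ] H :=
  f.sum fun s x => g.sum fun t y => π.condExp (Finsupp.single (s⁻¹ * t) (star x * y))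

/-- The action of `C_c(𝒜)` by left multiplication, `(a δ_s) (y δ_t) = π_s(a) y δ_{st}`. -/
noncomputable def act :
    𝒜.Cc →ₗ[ℂ] ((S →₀ (H →L[ℂ] H)) →ₗ[ℂ] (S →₀ (H →L[ℂ] H))) :=
  𝒜.lift fun s => LinearMap.flip <| Finsupp.lsum ℂ fun t =>
    ((LinearMap.mul ℂ (H →L[ℂ] H) ∘ₗ π.op s).compr₂ (Finsupp.lsingle (s * t))).flip

theorem act_single {s t : S} (a : 𝒜.fiber s) (y : H →L[ℂ] H) :
    π.act (𝒜.single s a) (Finsupp.single t y) = Finsupp.single (s * t) (π.op s a * y) := by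
  simp [act]

theorem act_mul (x y : 𝒜.Cc) (f : S →₀ (H →L[ℂ] H)) :
    π.act (x * y) f = π.act x (π.act y f) := by
  induction f using Finsupp.induction_linear with
  | zero => simp only [map_zero]
  | add f g hf hg => simp only [map_add, hf, hg]
  | single r z =>
    induction x using Cc.induction with
    | zero => simp only [zero_mul, map_zero, LinearMap.zero_apply]
    | add x x' hx hx' => simp only [add_mul, map_add, LinearMap.add_apply, hx, hx']
    | single s a =>
      induction y using Cc.induction with
      | zero => simp only [mul_zero, map_zero, LinearMap.zero_apply]
      | add x x' hx hx' => simp only [mul_add, map_add, LinearMap.add_apply, hx, hx']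
      | single t b =>
        rw [single_mul_single, act_single, act_single, act_single, ← π.op_mul, mul_assoc,
          mul_assoc]

theorem single_mem_ccVN {t : S} {y : H →L[ℂ] H} (hy : y ∈ π.vnFiber t) :
    Finsupp.single t y ∈ π.ccVN := by
  classical
  intro s
  rw [Finsupp.single_apply]
  split_ifs with h
  · subst h; exact hy
  · exact Submodule.zero_mem _

theorem act_mem (x : 𝒜.Cc) {f : S →₀ (H →L[ℂ] H)} (hf : f ∈ π.ccVN) : π.act x f ∈ π.ccVN := by
  induction x using Cc.induction with
  | zero => simp only [map_zero, LinearMap.zero_apply, Submodule.zero_mem]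
  | add x y hx hy =>
    rw [map_add, LinearMap.add_apply]
    exact Submodule.add_mem _ hx hy
  | single s a =>
    rw [← Finsupp.sum_single f, Finsupp.sum, map_sum]
    refine Submodule.sum_mem _ fun t _ => ?_
    rw [act_single]
    exact π.single_mem_ccVN (π.op_mul_mem_vnFiber a (hf t))

/-- Evaluation of a section at a vector. -/
noncomputable def evalAt (v : H) : (S →₀ (H →L[ℂ] H)) →ₗ[ℂ] π.Aux :=
  Finsupp.lsum ℂ fun s => π.auxSingle s ∘ₗ (ContinuousLinearMap.apply ℂ H v).toLinearMap

theorem evalAt_single (v : H) (s : S) (y : H →L[ℂ] H) :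
    π.evalAt v (Finsupp.single s y) = π.auxSingle s (y v) := by
  simp [evalAt]

theorem evalAt_eq_sum (v : H) (f : S →₀ (H →L[ℂ] H)) :
    π.evalAt v f = ∑ s ∈ f.support, π.auxSingle s (f s v) := rfl

theorem evalAt_act (v : H) (x : 𝒜.Cc) (f : S →₀ (H →L[ℂ] H)) :
    π.evalAt v (π.act x f) = π.auxAct x (π.evalAt v f) := by
  induction f using Finsupp.induction_linear with
  | zero => simp only [map_zero]
  | add f g hf hg => simp only [map_add, hf, hg]
  | single t y =>
    induction x using Cc.induction with
    | zero => simp only [map_zero, LinearMap.zero_apply]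
    | add x x' hx hx' => simp only [map_add, LinearMap.add_apply, hx, hx']
    | single s a => rw [act_single, evalAt_single, evalAt_single, auxAct_single]; rfl

theorem inner_evalAt (f : S →₀ (H →L[ℂ] H)) {g : S →₀ (H →L[ℂ] H)} (hg : g ∈ π.ccVN) (v w : H) :
    inner ℂ (π.evalAt v f) (π.evalAt w g) = inner ℂ v (π.vnInner f g w) := by
  rw [evalAt_eq_sum, evalAt_eq_sum, sum_inner, vnInner, Finsupp.sum]
  simp only [Finsupp.sum, sum_apply, inner_sum, inner_auxSingle]
  refine Finset.sum_congr rfl fun s _ => Finset.sum_congr rfl fun t _ => ?_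
  have h : π.condExp (Finsupp.single (s⁻¹ * t) (star (f s) * g t)) w =
      star (f s) (g t (π.one (s⁻¹ * t) w)) := by
    rw [condExp, Finsupp.lsum_single]
    rfl
  rw [h, π.vnFiber_swap (hg t), ContinuousLinearMap.star_eq_adjoint,
    ContinuousLinearMap.adjoint_inner_right, link_apply]

theorem norm_evalAt_le (f : π.ccVN) (v : H) :
    ‖π.evalAt v f‖ ≤ Real.sqrt ‖π.vnInner f f‖ * ‖v‖ := by
  refine le_of_sq_le_sq ?_ (by positivity)
  rw [mul_pow, Real.sq_sqrt (norm_nonneg _), norm_sq_eq_re_inner (𝕜 := ℂ), π.inner_evalAt _ f.2]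
  refine (RCLike.re_le_norm _).trans ((norm_inner_le_norm _ _).trans ?_)
  have := (π.vnInner f f).le_opNorm v
  nlinarith [norm_nonneg v]

/-- The operator `H → Aux` defined by a section. -/
noncomputable def evalCLM : π.ccVN →ₗ[ℂ] (H →L[ℂ] π.Aux) where
  toFun f := LinearMap.mkContinuous
    { toFun := fun v => π.evalAt v f
      map_add' := fun v w => by
        simp only [evalAt_eq_sum, map_add, Finset.sum_add_distrib]
      map_smul' := fun c v => by
        simp only [evalAt_eq_sum, map_smul, Finset.smul_sum, RingHom.id_apply] }
    (Real.sqrt ‖π.vnInner f f‖) (π.norm_evalAt_le f)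
  map_add' f g := by ext v; exact map_add (π.evalAt v) _ _
  map_smul' c f := by ext v; exact map_smul (π.evalAt v) _ _

theorem evalCLM_apply (f : π.ccVN) (v : H) : π.evalCLM f v = π.evalAt v f := rfl

theorem norm_vnInner_le (f g : π.ccVN) : ‖π.vnInner f g‖ ≤ ‖π.evalCLM f‖ * ‖π.evalCLM g‖ := by
  refine ContinuousLinearMap.opNorm_le_bound _ (by positivity) fun w => ?_
  set y := π.vnInner f g w with hy
  have h1 : ‖y‖ ^ 2 ≤ (‖π.evalCLM f‖ * ‖y‖) * (‖π.evalCLM g‖ * ‖w‖) := by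
    rw [norm_sq_eq_re_inner (𝕜 := ℂ)]
    nth_rewrite 2 [hy]
    rw [← π.inner_evalAt _ g.2]
    refine (RCLike.re_le_norm _).trans ((norm_inner_le_norm _ _).trans ?_)
    exact mul_le_mul ((π.evalCLM f).le_opNorm y) ((π.evalCLM g).le_opNorm w) (norm_nonneg _)
      (by positivity)
  rcases (norm_nonneg y).eq_or_lt with h0 | h0
  · rw [← h0]; positivity
  · refine le_of_mul_le_mul_right ?_ h0
    calc ‖y‖ * ‖y‖ = ‖y‖ ^ 2 := (sq _).symm
      _ ≤ _ := h1
      _ = _ := by ring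

theorem norm_evalCLM (f : π.ccVN) : ‖π.evalCLM f‖ = Real.sqrt ‖π.vnInner f f‖ := by
  refine le_antisymm
    (ContinuousLinearMap.opNorm_le_bound _ (Real.sqrt_nonneg _) (π.norm_evalAt_le f)) ?_
  refine Real.sqrt_le_iff.mpr ⟨norm_nonneg _, ?_⟩
  rw [sq]
  exact π.norm_vnInner_le f f

/-- The space `C_c(𝒜'')` with the seminorm `‖⟨f, f⟩‖^{1/2}`. -/
def PreEll2 : Type (max u w) := π.ccVN

noncomputable instance : AddCommGroup π.PreEll2 := inferInstanceAs (AddCommGroup π.ccVN)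
noncomputable instance : Module ℂ π.PreEll2 := inferInstanceAs (Module ℂ π.ccVN)

/-- The underlying section of an element of `PreEll2`. -/
noncomputable def toCcVN : π.PreEll2 →ₗ[ℂ] π.ccVN := LinearMap.id

noncomputable instance : SeminormedAddCommGroup π.PreEll2 :=
  AddGroupSeminorm.toSeminormedAddCommGroup (E := π.PreEll2)
    { toFun := fun f => Real.sqrt ‖π.vnInner (π.toCcVN f) (π.toCcVN f)‖
      map_zero' := by rw [← norm_evalCLM, map_zero, map_zero, norm_zero]
      add_le' := fun f g => by
        simp only [← norm_evalCLM, map_add]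
        exact norm_add_le _ _
      neg' := fun f => by simp only [← norm_evalCLM, map_neg, norm_neg] }

theorem norm_def (f : π.PreEll2) : ‖f‖ = Real.sqrt ‖π.vnInner (π.toCcVN f) (π.toCcVN f)‖ := rfl

theorem norm_eq (f : π.PreEll2) : ‖f‖ = ‖π.evalCLM (π.toCcVN f)‖ :=
  (π.norm_evalCLM (π.toCcVN f)).symm

noncomputable instance : NormedSpace ℂ π.PreEll2 where
  norm_smul_le c f := by
    rw [norm_eq, norm_eq, map_smul, map_smul, norm_smul]

/-- The Hilbert module `ℓ²(𝒜'')`: the Hausdorff completion of `C_c(𝒜'')` with respect to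
`‖f‖ = ‖⟨f, f⟩‖^{1/2}`. -/
abbrev Ell2 : Type (max u w) := UniformSpace.Completion π.PreEll2

/-- Left multiplication by an element of `C_c(𝒜)` on `C_c(𝒜'')`. -/
noncomputable def preAct : 𝒜.Cc →ₗ[ℂ] (π.PreEll2 →ₗ[ℂ] π.PreEll2) where
  toFun x := (π.act x).restrict (p := π.ccVN) (q := π.ccVN) fun _ hf => π.act_mem x hf
  map_add' x y := by
    refine LinearMap.ext fun f => Subtype.ext ?_
    change π.act (x + y) _ = π.act x _ + π.act y _
    rw [map_add, LinearMap.add_apply]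
  map_smul' c x := by
    refine LinearMap.ext fun f => Subtype.ext ?_
    change π.act (c • x) _ = c • π.act x _
    rw [map_smul, LinearMap.smul_apply]

theorem evalCLM_preAct (x : 𝒜.Cc) (f : π.PreEll2) (v : H) :
    π.evalCLM (π.toCcVN (π.preAct x f)) v = π.auxAct x (π.evalCLM (π.toCcVN f) v) :=
  π.evalAt_act v x (π.toCcVN f)

theorem preAct_mul (x y : 𝒜.Cc) (f : π.PreEll2) :
    π.preAct (x * y) f = π.preAct x (π.preAct y f) :=
  Subtype.ext (π.act_mul x y _)

theorem preAct_bound (x : 𝒜.Cc) : ∃ C : ℝ, ∀ f : π.PreEll2, ‖π.preAct x f‖ ≤ C * ‖f‖ := by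
  induction x using Cc.induction with
  | zero => exact ⟨0, fun f => by simp⟩
  | add x y hx hy =>
    obtain ⟨C, hC⟩ := hx
    obtain ⟨D, hD⟩ := hy
    refine ⟨C + D, fun f => ?_⟩
    rw [map_add, LinearMap.add_apply, add_mul]
    exact (norm_add_le _ _).trans (add_le_add (hC f) (hD f))
  | single s a =>
    refine ⟨‖π.op s a‖, fun f => ?_⟩
    rw [norm_eq, norm_eq]
    refine ContinuousLinearMap.opNorm_le_bound _ (by positivity) fun v => ?_
    rw [evalCLM_preAct, mul_assoc]
    exact (π.norm_auxAct_le a _).trans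
      (mul_le_mul_of_nonneg_left ((π.evalCLM _).le_opNorm v) (norm_nonneg _))

/-- Left multiplication by an element of `C_c(𝒜)`, as a bounded operator on `C_c(𝒜'')`. -/
noncomputable def preActCLM (x : 𝒜.Cc) : π.PreEll2 →L[ℂ] π.PreEll2 where
  toLinearMap := π.preAct x
  cont := AddMonoidHomClass.continuous_of_bound (π.preAct x) _ (π.preAct_bound x).choose_spec

theorem preActCLM_apply (x : 𝒜.Cc) (f : π.PreEll2) : π.preActCLM x f = π.preAct x f := rfl

/-- The regular representation `Λ` of `C_c(𝒜)` on `ℓ²(𝒜'')`, by left multiplication. -/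
noncomputable def regular (x : 𝒜.Cc) : π.Ell2 →L[ℂ] π.Ell2 := (π.preActCLM x).completion

theorem regular_coe (x : 𝒜.Cc) (f : π.PreEll2) :
    π.regular x (f : π.Ell2) = ((π.preAct x f : π.PreEll2) : π.Ell2) :=
  UniformSpace.Completion.map_coe (π.preActCLM x).uniformContinuous f

theorem regular_ext {T U : π.Ell2 →L[ℂ] π.Ell2} (h : ∀ f : π.PreEll2, T (f : π.Ell2) = U f) :
    T = U :=
  ContinuousLinearMap.ext fun z => congrFun
    (UniformSpace.Completion.ext T.continuous U.continuous h) z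

theorem regular_add (x y : 𝒜.Cc) : π.regular (x + y) = π.regular x + π.regular y :=
  π.regular_ext fun f => by
    simp only [add_apply, regular_coe, map_add, LinearMap.add_apply,
      UniformSpace.Completion.coe_add]

theorem regular_smul (c : ℂ) (x : 𝒜.Cc) : π.regular (c • x) = c • π.regular x :=
  π.regular_ext fun f => by
    simp only [smul_apply, regular_coe, map_smul, LinearMap.smul_apply,
      UniformSpace.Completion.coe_smul]

theorem regular_mul (x y : 𝒜.Cc) : π.regular (x * y) = π.regular x * π.regular y :=
  π.regular_ext fun f => by
    change _ = π.regular x (π.regular y f)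
    rw [regular_coe, regular_coe, regular_coe, preAct_mul]

theorem norm_regular_le {x : 𝒜.Cc} {C : ℝ} (hC : 0 ≤ C)
    (h : ∀ f : π.PreEll2, ‖π.preAct x f‖ ≤ C * ‖f‖) : ‖π.regular x‖ ≤ C := by
  refine ContinuousLinearMap.opNorm_le_bound _ hC fun z => ?_
  induction z using UniformSpace.Completion.induction_on with
  | hp => exact isClosed_le (by fun_prop) (by fun_prop)
  | ih f =>
    rw [regular_coe, UniformSpace.Completion.norm_coe, UniformSpace.Completion.norm_coe]
    exact h f

theorem norm_preAct_le (x : 𝒜.Cc) (f : π.PreEll2) : ‖π.preAct x f‖ ≤ ‖π.regular x‖ * ‖f‖ := by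
  have := (π.regular x).le_opNorm (f : π.Ell2)
  rwa [regular_coe, UniformSpace.Completion.norm_coe, UniformSpace.Completion.norm_coe] at this

theorem norm_regular_sq_le (x : 𝒜.Cc) : ‖π.regular x‖ ^ 2 ≤ ‖π.regular (star x * x)‖ := by
  rw [← Real.le_sqrt (norm_nonneg _) (norm_nonneg _)]
  refine π.norm_regular_le (Real.sqrt_nonneg _) fun f => ?_
  rw [norm_eq]
  refine ContinuousLinearMap.opNorm_le_bound _ (by positivity) fun v => ?_
  refine le_of_sq_le_sq ?_ (by positivity)
  rw [mul_pow, mul_pow, Real.sq_sqrt (norm_nonneg _), norm_sq_eq_re_inner (𝕜 := ℂ)]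
  nth_rewrite 1 [evalCLM_preAct]
  rw [auxAct_adjoint, ← evalCLM_preAct, ← preAct_mul]
  refine (RCLike.re_le_norm _).trans ((norm_inner_le_norm _ _).trans ?_)
  have h1 := (π.evalCLM (π.toCcVN f)).le_opNorm v
  have h2 := (π.evalCLM (π.toCcVN (π.preAct (star x * x) f))).le_opNorm v
  have h3 := π.norm_preAct_le (star x * x) f
  rw [← norm_eq] at h1 h2
  have h4 := h2.trans (mul_le_mul_of_nonneg_right h3 (norm_nonneg v))
  have h5 : 0 ≤ ‖π.evalCLM (π.toCcVN (π.preAct (star x * x) f)) v‖ := norm_nonneg _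
  have h6 : 0 ≤ ‖f‖ * ‖v‖ := mul_nonneg (norm_nonneg f) (norm_nonneg v)
  generalize ‖π.evalCLM (π.toCcVN (π.preAct (star x * x) f)) v‖ = b at *
  generalize ‖π.evalCLM (π.toCcVN f) v‖ = c at *
  generalize ‖π.regular (star x * x)‖ = r at *
  calc c * b ≤ (‖f‖ * ‖v‖) * (r * ‖f‖ * ‖v‖) := mul_le_mul h1 h4 h5 h6
    _ = r * ‖f‖ ^ 2 * ‖v‖ ^ 2 := by ring

/-- The reduced seminorm `‖x‖_r = ‖Λ(x)‖` on `C_c(𝒜)`. -/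
noncomputable def redSeminorm : CStarSeminorm 𝒜.Cc :=
  CStarSeminorm.ofLe
    { toFun := fun x => ‖π.regular x‖
      map_zero' := by
        have := π.regular_smul 0 0
        rw [zero_smul, zero_smul] at this
        rw [this, norm_zero]
      add_le' := fun x y => by
        rw [regular_add]
        exact norm_add_le _ _
      neg' := fun x => by rw [← neg_one_smul ℂ x, regular_smul, norm_smul, norm_neg, norm_one, one_mul]
      smul' := fun c x => by rw [regular_smul, norm_smul] }
    (fun x y => by
      change ‖π.regular (x * y)‖ ≤ ‖π.regular x‖ * ‖π.regular y‖
      rw [regular_mul]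
      exact norm_mul_le _ _)
    π.norm_regular_sq_le

theorem redSeminorm_apply (x : 𝒜.Cc) : π.redSeminorm.toSeminorm x = ‖π.regular x‖ := rfl

theorem norm_auxSingle_sub {u w : S} (h : u ≤ w) {k : H} (hk : k ∈ π.unitSpace (u * u⁻¹) 1) :
    ‖π.auxSingle u k - π.auxSingle w k‖ = 0 := by
  have hl : ∀ r s : S, u ≤ r → u ≤ s → π.link r s k = k := fun r s hr hs =>
    π.one_apply_eq (π.unitSpace_mono (mul_le_mul'' hr (inv_le_inv' hs)) hk)
  have hu := le_refl' u
  rw [← sq_eq_zero_iff, norm_sq_eq_re_inner (𝕜 := ℂ)]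
  simp only [inner_sub_left, inner_sub_right, inner_auxSingle, hl _ _ hu hu, hl _ _ hu h,
    hl _ _ h hu, hl _ _ h h, sub_self, map_zero]

theorem redSeminorm_admissible : 𝒜.Admissible π.redSeminorm := by
  intro s t h a
  rw [redSeminorm_apply]
  refine le_antisymm (π.norm_regular_le le_rfl fun f => ?_) (norm_nonneg _)
  rw [zero_mul, norm_eq]
  refine ContinuousLinearMap.opNorm_le_bound _ le_rfl fun v => ?_
  rw [zero_mul, evalCLM_preAct, evalCLM_apply, evalAt_eq_sum, map_sum]
  refine (norm_sum_le _ _).trans (Finset.sum_nonpos fun r _ => ?_)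
  rw [map_sub, LinearMap.sub_apply, auxAct_single, auxAct_single, π.op_incl]
  refine (π.norm_auxSingle_sub (mul_le_mul'' h (le_refl' r)) ?_).le
  refine π.op_map_unitSpace a (u := r * r⁻¹) (fun e _ he => ?_) _
    (π.vnFiber_apply_mem ((π.toCcVN f).2 r) v)
  have h1 : s * r * (s * r)⁻¹ = s * (r * r⁻¹) * s⁻¹ := by
    rw [mul_inv_rev']; simp only [mul_assoc]
  rw [h1]
  exact mul_le_mul'' (mul_le_mul'' (le_refl' s) he) (le_refl' _)

end FellBundle.Rep

namespace FellBundle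

variable {S : Type u} [InverseMonoid S] (𝒜 : FellBundle.{u, v} S)

/-- The reduced cross-sectional C*-algebra `C^*_r(𝒜)`: the completion of `C_c(𝒜)` in the norm
`‖x‖_r = ‖Λ(x)‖`, i.e. the closure of `Λ(C_c(𝒜))` in the adjointable operators on `ℓ²(𝒜'')`. -/
abbrev RedAlg : Type (max u v) := 𝒜.univRep.redSeminorm.Compl

/-- The regular representation `Λ : C^*(𝒜) → C^*_r(𝒜)`, the extension of the identity of
`C_c(𝒜)`. -/
noncomputable def regularRep : 𝒜.FullAlg →⋆ₙₐ[ℂ] 𝒜.RedAlg :=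
  CStarSeminorm.mapCompl 𝒜.maxSeminorm 𝒜.univRep.redSeminorm
    (𝒜.le_maxSeminorm _ 𝒜.univRep.redSeminorm_admissible)

/-- The weak containment property: `Λ : C^*(𝒜) → C^*_r(𝒜)` is a *-isomorphism. -/
def HasWeakContainmentProperty : Prop := Function.Bijective 𝒜.regularRep

open Filter Topology in
/-- The approximation property: there is a net `ξ_i` of finitely supported functions
`ξ_i : S → A_1` with `ξ_i(s) ∈ A_{s s^*}` such that the norms of
`∑_{p,t} ξ_i(p)^* ξ_i(t) 1_{p t^*}` are bounded, and
`∑_{p,t} 1_{p (s t)^*} ξ_i(p)^* a ξ_i(t) → a` in norm for all `s` and `a ∈ A_s`. The expressions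
are formed in the enveloping von Neumann algebra of `C^*(𝒜)`. -/
def HasApproximationProperty : Prop :=
  ∃ (I : Type w) (_ : Preorder I) (_ : IsDirectedOrder I) (_ : Nonempty I)
    (ξ : I → (S →₀ 𝒜.fiber 1)),
    (∀ i s, ξ i s ∈ Set.range (𝒜.incl (mul_inv_le_one s))) ∧
    (∃ C : ℝ, ∀ i, ‖(ξ i).sum fun p x => (ξ i).sum fun t y =>
      star (𝒜.univRep.op 1 x) * 𝒜.univRep.op 1 y * 𝒜.univRep.one (p * t⁻¹)‖ ≤ C) ∧
    ∀ (s : S) (a : 𝒜.fiber s),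
      Tendsto (fun i => (ξ i).sum fun p x => (ξ i).sum fun t y =>
        𝒜.univRep.one (p * (s * t)⁻¹) * star (𝒜.univRep.op 1 x) * 𝒜.univRep.op s a *
          𝒜.univRep.op 1 y)
        atTop (𝓝 (𝒜.univRep.op s a))

end FellBundle

/-! The approximation property approximates the universal representation `π` of `C^*(𝒜)` by
compressions of a representation that factors through the reduced algebra. Let `σ` (`auxAct`) be the
left action of `C_c(𝒜)` on `Aux`, the finitely supported functions `S → H` with `⟪h δ_s, k δ_t⟫ =
⟪h, 1_{s t^*} k⟫`. Three facts about `σ` carry the proof.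

Compressions. A function `ξ` with `ξ(t) ∈ A_{t t^*}` gives the operator `V h = ∑_t ξ(t) h δ_t`
(`auxVector`). Then `V^* V` is the sum in condition (i) (`inner_auxVector_self`), and `V^* σ(a δ_s)
V` is the sum in condition (ii) (`inner_auxVector_auxAct_single`). The property thus provides
operators `V_i` of norm at most `√C` such that the matrix coefficients of `V_i^* σ(x) V_i` converge
to those of `π(x)`, for every `x ∈ C_c(𝒜)`.

Domination by the full norm. On the span of the `w δ_r` with `w` in the closed span of `π(A_{r r^*})
H`, which contains the ranges of the `V_i`, the action identifies `a δ_s` with `a δ_t` for `s ≤ t`.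
It therefore defines an admissible C*-seminorm, and `‖σ(x) k‖ ≤ ‖x‖_max ‖k‖` there
(`norm_auxAct_le_maxSeminorm`).

Control by the reduced norm. A vector `π(c) v δ_1` is the value at `v` of the section `c δ_1`, so
`σ(x)` on it is bounded by `‖Λ(x)‖`. Right translation by `r` commutes with `σ` and preserves norms
of sections evaluated at `v`, provided `v` lies in the range of `1_{r r^*}`
(`norm_auxTranslate_evalAt`, resting on `link_mul_right`). This gives the same control of `π(c) v
δ_r`, and an approximation argument reaches all `V_i k` (`tendsto_auxAct_auxSingle`).

Now let `Λ(b) = 0` and let sections `x` tend to `b` in the full norm. Then `σ(x) V_i k → 0`, and in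
fact `‖σ(x) V_i k‖ ≤ ‖x - b‖ √C ‖k‖` uniformly in `i`. Letting first `i` and then `x` run gives `⟪v,
π(b) k⟫ = 0`, whence `b = 0` because `π` is faithful (`univHom_injective`). Surjectivity is
automatic: an injective *-homomorphism of C*-algebras is isometric, so its dense range is closed. -/

/-! ### Faithfulness of the universal representation -/

section Functionals

open scoped ComplexOrder ComplexStarModule

variable {A : Type v} [NonUnitalCStarAlgebra A] [PartialOrder A] [StarOrderedRing A]

/-- The positive linear functional `x ↦ g (Re x) + i g (Im x)` defined by a real functional `g`
that is nonnegative on the positive elements. -/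
noncomputable def positiveFunctionalOfReal (g : A →ₗ[ℝ] ℝ) (hg : ∀ x : A, 0 ≤ x → 0 ≤ g x) :
    A →ₚ[ℂ] ℂ :=
  PositiveLinearMap.mk₀
    { toFun := fun x => (g (ℜ x : A) : ℂ) + Complex.I * (g (ℑ x : A) : ℂ)
      map_add' := fun x y => by
        simp only [map_add, AddSubgroup.coe_add, Complex.ofReal_add]
        ring
      map_smul' := fun c x => by
        rw [realPart_smul, imaginaryPart_smul]
        simp only [AddSubgroup.coe_sub, AddSubgroup.coe_add, selfAdjoint.val_smul, map_sub, map_add,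
          map_smul, smul_eq_mul, Complex.ofReal_sub, Complex.ofReal_add, Complex.ofReal_mul,
          RingHom.id_apply]
        conv_rhs => rw [← Complex.re_add_im c]
        linear_combination (-(c.im : ℂ) * (g (ℑ x : A) : ℂ)) * Complex.I_mul_I }
    fun x hx => by
      have hsa : IsSelfAdjoint x := IsSelfAdjoint.of_nonneg hx
      simp only [LinearMap.coe_mk, AddHom.coe_mk, hsa.coe_realPart, hsa.imaginaryPart,
        ZeroMemClass.coe_zero, map_zero, Complex.ofReal_zero, mul_zero, add_zero]
      exact_mod_cast hg x hx

theorem positiveFunctionalOfReal_apply (g : A →ₗ[ℝ] ℝ) (hg : ∀ x : A, 0 ≤ x → 0 ≤ g x) {x : A}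
    (hx : IsSelfAdjoint x) : positiveFunctionalOfReal g hg x = g x := by
  change (g (ℜ x : A) : ℂ) + Complex.I * (g (ℑ x : A) : ℂ) = g x
  simp only [hx.coe_realPart, hx.imaginaryPart, ZeroMemClass.coe_zero, map_zero,
    Complex.ofReal_zero, mul_zero, add_zero]

/-- The positive linear functionals on a C*-algebra separate zero from the other positive
elements. -/
theorem exists_positiveFunctional_ne_zero {c : A} (hc : 0 ≤ c) (hc0 : c ≠ 0) :
    ∃ f : A →ₚ[ℂ] ℂ, f c ≠ 0 := by
  have hneg : -c ∉ {a : A | 0 ≤ a} := fun h =>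
    hc0 (le_antisymm (neg_nonneg.mp h) hc)
  have hconv : Convex ℝ {a : A | 0 ≤ a} := fun x hx y hy a b ha hb _ =>
    add_nonneg (smul_nonneg ha hx) (smul_nonneg hb hy)
  obtain ⟨g, r, hr, hg⟩ :=
    geometric_hahn_banach_point_closed hconv CStarAlgebra.isClosed_nonneg hneg
  have hr0 : r < 0 := by simpa using hg 0 (le_refl (0 : A))
  have hpos : ∀ x : A, 0 ≤ x → 0 ≤ g x := fun x hx => by
    by_contra! hlt
    -- If `g x < 0`, the nonnegative multiple `(r / g x) • x` stays in the cone and takes the value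
    -- exactly `r`, against the strict separation.
    have h1 := hg ((r / g x) • x) (smul_nonneg (div_nonneg_of_nonpos hr0.le hlt.le) hx)
    rw [map_smul, smul_eq_mul, div_mul_cancel₀ _ hlt.ne] at h1
    exact lt_irrefl _ h1
  refine ⟨positiveFunctionalOfReal g.toLinearMap hpos, ?_⟩
  rw [positiveFunctionalOfReal_apply _ _ (IsSelfAdjoint.of_nonneg hc)]
  rw [map_neg] at hr
  exact Complex.ofReal_ne_zero.mpr (by simp only [ContinuousLinearMap.coe_coe]; linarith)

/-- The GNS operator of `b` sends the class of `a` to the class of `b a`, whose squared norm is the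
value in question. The factor `a` takes the place of a cyclic vector, since the algebra need not
have a unit. -/
theorem PositiveLinearMap.apply_eq_zero_of_gns (f : A →ₚ[ℂ] ℂ) {b : A}
    (h : f.gnsNonUnitalStarAlgHom b = 0) (a : A) : f (star (b * a) * (b * a)) = 0 := by
  have h1 := f.gnsNonUnitalStarAlgHom_apply_coe (a := b) (b := f.toPreGNS a)
  rw [h] at h1
  have h2 : ‖f.toPreGNS (b * a)‖ = 0 := by
    rw [← UniformSpace.Completion.norm_coe]
    have : ((f.toPreGNS (b * a) : f.PreGNS) : f.GNS) = 0 := h1.symm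
    rw [this, norm_zero]
  have h3 := f.preGNS_norm_sq (f.toPreGNS (b * a))
  rw [h2] at h3
  simpa using h3.symm

end Functionals

namespace FellBundle

variable {S : Type u} [InverseMonoid S] (𝒜 : FellBundle.{u, v} S)

-- An element killed by every GNS representation satisfies `f ((b a)^* (b a)) = 0` for all `f` and
-- `a`. With `a = b^*` this contradicts Hahn–Banach separation from the positive cone unless `b
-- b^*`, hence `b`, vanishes; no approximate unit is needed.
open scoped ComplexOrder in
theorem univHom_injective : Function.Injective 𝒜.univHom := by
  rw [injective_iff_map_eq_zero]
  intro b hb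
  have hgns : ∀ f : 𝒜.FullAlg →ₚ[ℂ] ℂ, f.gnsNonUnitalStarAlgHom b = 0 := fun f => by
    classical
    ext x
    -- The universal representation is diagonal, so its `f`-coordinate on a vector supported at `f`
    -- is the GNS representation of `f`.
    have h1 := congrArg (fun T => T (lp.single 2 f x) f) hb
    simpa [univHom, directSumRep] using h1
  by_contra hne
  have hc0 : star (b * star b) * (b * star b) ≠ 0 := by
    rw [Ne, CStarRing.star_mul_self_eq_zero_iff, CStarRing.mul_star_self_eq_zero_iff]
    exact hne
  obtain ⟨f, hf⟩ := exists_positiveFunctional_ne_zero (star_mul_self_nonneg (b * star b)) hc0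
  exact hf (f.apply_eq_zero_of_gns (hgns f) (star b))

end FellBundle

/-- The range of an operator `T` is contained in the closure of the range of `T T^*`. -/
theorem ContinuousLinearMap.apply_mem_closure_range_mul_star {H : Type w} [NormedAddCommGroup H]
    [InnerProductSpace ℂ H] [CompleteSpace H] (T : H →L[ℂ] H) (x : H) :
    T x ∈ closure (Set.range fun v => T (star T v)) := by
  let M : Submodule ℂ H := (LinearMap.range (T * star T).toLinearMap).topologicalClosure
  have hM : IsClosed (M : Set H) := Submodule.isClosed_topologicalClosure _
  have : CompleteSpace M := hM.completeSpace_coe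
  suffices h : T x ∈ M from h
  rw [← Submodule.orthogonal_orthogonal M, Submodule.mem_orthogonal]
  intro y hy
  -- A vector `y` orthogonal to the range of `T T^*` satisfies `⟪T^* y, T^* y⟫ = ⟪y, T T^* y⟫ = 0`,
  -- so it is also orthogonal to the range of `T`.
  have h1 : star T y = 0 := by
    rw [← inner_self_eq_zero (𝕜 := ℂ)]
    nth_rewrite 1 [ContinuousLinearMap.star_eq_adjoint]
    rw [ContinuousLinearMap.adjoint_inner_left]
    exact inner_eq_zero_symm.mp (Submodule.mem_orthogonal M y |>.mp hy _
      (Submodule.le_topologicalClosure _ ⟨y, rfl⟩))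
  rw [← ContinuousLinearMap.adjoint_inner_left, ← ContinuousLinearMap.star_eq_adjoint, h1,
    inner_zero_left]

namespace FellBundle.Rep

variable {S : Type u} [InverseMonoid S] {𝒜 : FellBundle.{u, v} S}
  {H : Type w} [NormedAddCommGroup H] [InnerProductSpace ℂ H] [CompleteSpace H]
  (π : 𝒜.Rep H)

/-! ### The essential part of the auxiliary space -/

/-- The span of the `w δ_r` with `w` in the closed linear span of `π(A_{r r^*}) H`. -/
noncomputable def essAux : Submodule ℂ π.Aux :=
  Submodule.span ℂ {k | ∃ (r : S) (w : H), w ∈ π.unitSpace (r * r⁻¹) 1 ∧ π.auxSingle r w = k}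

theorem auxSingle_mem_essAux {r : S} {w : H} (hw : w ∈ π.unitSpace (r * r⁻¹) 1) :
    π.auxSingle r w ∈ π.essAux :=
  Submodule.subset_span ⟨r, w, hw, rfl⟩

/-- Multiplication by `A_s` conjugates idempotents by `s`, and `(s r)(s r)^* = s (r r^*) s^*`. This
makes the essential part invariant under the action. -/
theorem op_apply_mem_unitSpace_mul {s r : S} (a : 𝒜.fiber s) {w : H}
    (hw : w ∈ π.unitSpace (r * r⁻¹) 1) : π.op s a w ∈ π.unitSpace (s * r * (s * r)⁻¹) 1 := by
  refine π.op_map_unitSpace a (fun e _ he => ?_) _ hw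
  have h1 : s * r * (s * r)⁻¹ = s * (r * r⁻¹) * s⁻¹ := by
    rw [mul_inv_rev']; simp only [mul_assoc]
  rw [h1]
  exact mul_le_mul'' (mul_le_mul'' (le_refl' s) he) (le_refl' _)

theorem auxAct_mem_essAux (x : 𝒜.Cc) {k : π.Aux} (hk : k ∈ π.essAux) :
    π.auxAct x k ∈ π.essAux := by
  induction x using Cc.induction with
  | zero => rw [map_zero]; exact Submodule.zero_mem _
  | add x y hx hy => rw [map_add]; exact Submodule.add_mem _ hx hy
  | single s a =>
    suffices h : π.essAux ≤ π.essAux.comap (π.auxAct (𝒜.single s a)) from h hk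
    refine Submodule.span_le.mpr ?_
    rintro _ ⟨r, w, hw, rfl⟩
    change π.auxAct (𝒜.single s a) (π.auxSingle r w) ∈ π.essAux
    rw [auxAct_single]
    exact π.auxSingle_mem_essAux (π.op_apply_mem_unitSpace_mul a hw)

theorem auxAct_mul (x y : 𝒜.Cc) (k : π.Aux) :
    π.auxAct (x * y) k = π.auxAct x (π.auxAct y k) := by
  obtain ⟨F, z, rfl⟩ := π.aux_eq_sum k
  simp only [map_sum]
  refine Finset.sum_congr rfl fun r _ => ?_
  induction x using Cc.induction with
  | zero => simp only [zero_mul, map_zero, LinearMap.zero_apply]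
  | add x x' hx hx' => simp only [add_mul, map_add, LinearMap.add_apply, hx, hx']
  | single s a =>
    induction y using Cc.induction with
    | zero => simp only [mul_zero, map_zero, LinearMap.zero_apply]
    | add x x' hx hx' => simp only [mul_add, map_add, LinearMap.add_apply, hx, hx']
    | single t b =>
      rw [single_mul_single, auxAct_single, auxAct_single, auxAct_single, op_op_apply, mul_assoc]

theorem auxAct_bound (x : 𝒜.Cc) : ∃ C : ℝ, ∀ k : π.Aux, ‖π.auxAct x k‖ ≤ C * ‖k‖ := by
  induction x using Cc.induction with
  | zero => exact ⟨0, fun k => by simp⟩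
  | single s a => exact ⟨‖π.op s a‖, π.norm_auxAct_le a⟩
  | add x y hx hy =>
    obtain ⟨C, hC⟩ := hx
    obtain ⟨D, hD⟩ := hy
    refine ⟨C + D, fun k => ?_⟩
    rw [map_add, LinearMap.add_apply, add_mul]
    exact (norm_add_le _ _).trans (add_le_add (hC k) (hD k))

/-- The action of `C_c(𝒜)` by bounded operators on the essential part of the auxiliary space. -/
noncomputable def essAct (x : 𝒜.Cc) : π.essAux →L[ℂ] π.essAux where
  toLinearMap := (π.auxAct x).restrict fun _ hk => π.auxAct_mem_essAux x hk
  cont := AddMonoidHomClass.continuous_of_bound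
    ((π.auxAct x).restrict fun _ hk => π.auxAct_mem_essAux x hk) (π.auxAct_bound x).choose
    fun k => (π.auxAct_bound x).choose_spec k

theorem norm_auxAct_le_essAct (x : 𝒜.Cc) {k : π.Aux} (hk : k ∈ π.essAux) :
    ‖π.auxAct x k‖ ≤ ‖π.essAct x‖ * ‖k‖ :=
  (π.essAct x).le_opNorm ⟨k, hk⟩

noncomputable instance : SeminormedAddCommGroup (π.essAux →L[ℂ] π.essAux) :=
  ContinuousLinearMap.toSeminormedAddCommGroup

noncomputable instance : NormedSpace ℂ (π.essAux →L[ℂ] π.essAux) :=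
  ContinuousLinearMap.toNormedSpace

/-- The action is a *-representation, so `‖x k‖² = ⟪k, x^* x k⟫`, and Cauchy–Schwarz applies. -/
theorem norm_essAct_sq_le (x : 𝒜.Cc) : ‖π.essAct x‖ ^ 2 ≤ ‖π.essAct (star x * x)‖ := by
  rw [← Real.le_sqrt (norm_nonneg _) (norm_nonneg _)]
  refine ContinuousLinearMap.opNorm_le_bound _ (Real.sqrt_nonneg _) fun k => ?_
  refine le_of_sq_le_sq ?_ (by positivity)
  rw [mul_pow, Real.sq_sqrt (norm_nonneg _)]
  change ‖π.auxAct x k‖ ^ 2 ≤ _ * ‖(k : π.Aux)‖ ^ 2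
  rw [norm_sq_eq_re_inner (𝕜 := ℂ), auxAct_adjoint, ← auxAct_mul]
  refine (RCLike.re_le_norm _).trans ((norm_inner_le_norm _ _).trans ?_)
  calc ‖(k : π.Aux)‖ * ‖π.auxAct (star x * x) k‖
      ≤ ‖(k : π.Aux)‖ * (‖π.essAct (star x * x)‖ * ‖(k : π.Aux)‖) :=
        mul_le_mul_of_nonneg_left (π.norm_auxAct_le_essAct _ k.2) (norm_nonneg _)
    _ = _ := by ring

/-- The C*-seminorm on `C_c(𝒜)` given by its action on the essential part of the auxiliary
space. -/
noncomputable def essSeminorm : CStarSeminorm 𝒜.Cc :=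
  have hadd : ∀ x y, π.essAct (x + y) = π.essAct x + π.essAct y := fun x y => by
    ext k
    change π.auxAct (x + y) k = π.auxAct x k + π.auxAct y k
    rw [map_add, LinearMap.add_apply]
  have hsmul : ∀ (c : ℂ) x, π.essAct (c • x) = c • π.essAct x := fun c x => by
    ext k
    change π.auxAct (c • x) k = c • π.auxAct x k
    rw [map_smul, LinearMap.smul_apply]
  CStarSeminorm.ofLe
    (Seminorm.of (fun x => ‖π.essAct x‖)
      (fun x y => by rw [hadd]; exact norm_add_le _ _)
      (fun c x => by rw [hsmul]; exact norm_smul c (π.essAct x)))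
    (fun x y => by
      refine ContinuousLinearMap.opNorm_le_bound _ (by positivity) fun k => ?_
      change ‖π.auxAct (x * y) k‖ ≤ ‖π.essAct x‖ * ‖π.essAct y‖ * ‖(k : π.Aux)‖
      rw [auxAct_mul, mul_assoc]
      exact (π.norm_auxAct_le_essAct x (π.auxAct_mem_essAux y k.2)).trans
        (mul_le_mul_of_nonneg_left (π.norm_auxAct_le_essAct y k.2) (norm_nonneg _)))
    π.norm_essAct_sq_le

/-- On `w δ_r` the two sections give `π(a) w δ_{sr}` and `π(a) w δ_{tr}` with `sr ≤ tr`. As `π(a) w`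
is fixed by the projection of `(sr)(sr)^*`, all four inner products between these vectors agree and
their difference has norm zero. -/
theorem essSeminorm_admissible : 𝒜.Admissible π.essSeminorm := by
  intro s t h a
  change ‖π.essAct _‖ = 0
  refine le_antisymm (ContinuousLinearMap.opNorm_le_bound _ le_rfl fun k => ?_) (norm_nonneg _)
  obtain ⟨k, hk⟩ := k
  change ‖π.auxAct (𝒜.single s a - 𝒜.single t (𝒜.incl h a)) k‖ ≤ 0 * ‖k‖
  rw [zero_mul]
  induction hk using Submodule.span_induction with
  | zero => rw [map_zero, norm_zero]
  | add x y _ _ hx hy =>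
    rw [map_add]
    exact (norm_add_le _ _).trans (by linarith)
  | smul c x _ hx =>
    rw [map_smul, norm_smul]
    exact mul_nonpos_of_nonneg_of_nonpos (norm_nonneg c) hx
  | mem x hx =>
    obtain ⟨r, w, hw, rfl⟩ := hx
    rw [map_sub, LinearMap.sub_apply, auxAct_single, auxAct_single, π.op_incl]
    exact (π.norm_auxSingle_sub (mul_le_mul'' h (le_refl' r))
      (π.op_apply_mem_unitSpace_mul a hw)).le

/-- Maximality of the full seminorm among admissible ones. Unlike the constants in `auxAct_bound`,
this bound is continuous for the full norm, so it survives passage from sections to elements of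
`C^*(𝒜)`. -/
theorem norm_auxAct_le_maxSeminorm (x : 𝒜.Cc) {k : π.Aux} (hk : k ∈ π.essAux) :
    ‖π.auxAct x k‖ ≤ 𝒜.maxSeminorm.toSeminorm x * ‖k‖ :=
  (π.norm_auxAct_le_essAct x hk).trans (mul_le_mul_of_nonneg_right
    (𝒜.le_maxSeminorm _ π.essSeminorm_admissible x) (norm_nonneg k))

/-! ### Right translations -/

/-- The right translation `h δ_t ↦ h δ_{tr}` of the auxiliary space. -/
noncomputable def auxTranslate (r : S) : π.Aux →ₗ[ℂ] π.Aux :=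
  (Finsupp.lsum ℂ fun t => π.auxSingle (t * r)) ∘ₗ π.toAux.symm.toLinearMap

theorem auxTranslate_single (r t : S) (h : H) :
    π.auxTranslate r (π.auxSingle t h) = π.auxSingle (t * r) h := by
  simp [auxTranslate, auxSingle]

/-- Left and right multiplication on the index commute. This is what transports estimates from `δ_1`
to `δ_r`. -/
theorem auxTranslate_auxAct (r : S) (x : 𝒜.Cc) (k : π.Aux) :
    π.auxTranslate r (π.auxAct x k) = π.auxAct x (π.auxTranslate r k) := by
  obtain ⟨F, z, rfl⟩ := π.aux_eq_sum k
  simp only [map_sum]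
  refine Finset.sum_congr rfl fun t _ => ?_
  induction x using Cc.induction with
  | zero => simp only [map_zero, LinearMap.zero_apply]
  | add x y hx hy => simp only [map_add, LinearMap.add_apply, hx, hy]
  | single s a =>
    rw [auxAct_single, auxTranslate_single, auxTranslate_single, auxAct_single, mul_assoc]

/-- With `e = r r^*`, the left side involves `1_{t e u^*}` and the right side the larger projection
`1_{t u^*}`. They agree on the range of `1_{u e u^*}` because `t e u^* = (t u^*)(u e u^*)`. -/
theorem link_mul_right {r t u : S} {y : H} (hy : y ∈ π.unitSpace (u * (r * r⁻¹) * u⁻¹) 1) :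
    π.link (t * r) (u * r) y = π.link t u y := by
  set e := r * r⁻¹ with he
  have hee : e * e = e := idem_mul_inv r
  have h0 : t * r * (u * r)⁻¹ = t * e * u⁻¹ := by
    rw [mul_inv_rev', he]; simp only [mul_assoc]
  have hle : t * e * u⁻¹ ≤ t * u⁻¹ := mul_le_mul'' (mul_idem_le t hee) (le_refl' _)
  have h1 : t * u⁻¹ * (u * e * u⁻¹) = t * e * u⁻¹ := by
    calc t * u⁻¹ * (u * e * u⁻¹) = t * ((u⁻¹ * u) * e) * u⁻¹ := by simp only [mul_assoc]
      _ = t * e * (u⁻¹ * u * u⁻¹) := by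
          rw [idem_comm (idem_inv_mul u) hee]; simp only [mul_assoc]
      _ = t * e * u⁻¹ := by rw [inv_mul_inv]
  -- Since `y = 1_{u e u^*} y`, the vector `1_{t u^*} y` is in the range of `1_{t u^*} 1_{u e u^*}`,
  -- which lies under the projection of the product of the indices.
  have h2 : π.one (t * u⁻¹) y ∈ π.unitSpace (t * e * u⁻¹) 1 := by
    have := π.one_mul_one_mem (t * u⁻¹) (u * e * u⁻¹) y
    rwa [π.one_apply_eq hy, h1] at this
  have h3 : π.one (t * e * u⁻¹) (π.one (t * u⁻¹) y) = π.one (t * e * u⁻¹) y := by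
    have := π.one_mul_eq_of_le hle
    rw [π.one_comm] at this
    exact DFunLike.congr_fun this y
  rw [link_apply, link_apply, h0, ← h3, π.one_apply_eq h2]

/-- Elements of `A_u''` intertwine `1_{r r^*}` with `1_{u r r^* u^*}`, so `f(u) v` lies where
`link_mul_right` applies, and the Gram matrix of the vectors `f(u) v δ_u` is unchanged by
translation. -/
theorem norm_auxTranslate_evalAt {r : S} {v : H} (hv : v ∈ π.unitSpace (r * r⁻¹) 1)
    {f : S →₀ (H →L[ℂ] H)} (hf : f ∈ π.ccVN) :
    ‖π.auxTranslate r (π.evalAt v f)‖ = ‖π.evalAt v f‖ := by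
  have hmem : ∀ u, f u v ∈ π.unitSpace (u * (r * r⁻¹) * u⁻¹) 1 := fun u => by
    have h := π.vnFiber_intertwine _ _ (fun a => π.op_mul_one_conj a (r * r⁻¹)) (hf u)
    have h' : f u (π.one (r * r⁻¹) v) = π.one (u * (r * r⁻¹) * u⁻¹) (f u v) :=
      DFunLike.congr_fun h v
    rw [π.one_apply_eq hv] at h'
    rw [h']
    exact π.one_apply_mem _ _
  refine (sq_eq_sq₀ (norm_nonneg _) (norm_nonneg _)).mp ?_
  rw [norm_sq_eq_re_inner (𝕜 := ℂ), norm_sq_eq_re_inner (𝕜 := ℂ), evalAt_eq_sum]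
  simp only [map_sum, auxTranslate_single, sum_inner, inner_sum, inner_auxSingle,
    π.link_mul_right (hmem _)]

theorem norm_auxSingle_le (r : S) (w : H) : ‖π.auxSingle r w‖ ≤ ‖w‖ := by
  refine le_of_sq_le_sq ?_ (norm_nonneg w)
  rw [norm_sq_eq_re_inner (𝕜 := ℂ), inner_auxSingle, sq]
  refine (RCLike.re_le_norm _).trans ((norm_inner_le_norm _ _).trans ?_)
  exact mul_le_mul_of_nonneg_left (Submodule.norm_starProjection_apply_le _ w) (norm_nonneg w)

theorem op_mem_vnFiber {s : S} (a : 𝒜.fiber s) : π.op s a ∈ π.vnFiber s :=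
  Submodule.le_topologicalClosure _ ⟨_, ⟨a, rfl⟩, rfl⟩

/-- The action on `π_1(c) v δ_r` is controlled by the regular representation. -/
theorem norm_auxAct_auxSingle_le {r : S} {v : H} (hv : v ∈ π.unitSpace (r * r⁻¹) 1)
    (c : 𝒜.fiber 1) : ∃ D : ℝ, ∀ x : 𝒜.Cc,
      ‖π.auxAct x (π.auxSingle r (π.op 1 c v))‖ ≤ π.redSeminorm.toSeminorm x * D := by
  have hf : Finsupp.single 1 (π.op 1 c) ∈ π.ccVN := π.single_mem_ccVN (π.op_mem_vnFiber c)
  let f : π.PreEll2 := (⟨_, hf⟩ : π.ccVN)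
  -- Here `f` is the section `c δ_1`, whose norm in `ℓ²(𝒜'')` does not depend on `x`.
  refine ⟨‖f‖ * ‖v‖, fun x => ?_⟩
  have h1 : π.auxSingle r (π.op 1 c v) =
      π.auxTranslate r (π.evalAt v (Finsupp.single 1 (π.op 1 c))) := by
    rw [evalAt_single, auxTranslate_single, one_mul]
  rw [h1, ← auxTranslate_auxAct, ← evalAt_act, π.norm_auxTranslate_evalAt hv (π.act_mem x hf),
    redSeminorm_apply, ← mul_assoc]
  refine ((π.evalCLM (π.toCcVN (π.preAct x f))).le_opNorm v).trans ?_
  rw [← norm_eq]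
  exact mul_le_mul_of_nonneg_right (π.norm_preAct_le x f) (norm_nonneg v)

end FellBundle.Rep

/-! ### Estimates by the reduced seminorm, and compressions by functions `S → A_1` -/

namespace FellBundle.Rep

variable {S : Type u} [InverseMonoid S] {𝒜 : FellBundle.{u, v} S}
  {H : Type w} [NormedAddCommGroup H] [InnerProductSpace ℂ H] [CompleteSpace H]
  (π : 𝒜.Rep H)

open Filter Topology

theorem op_one_apply_mem_unitSpace {e : S} (he : e * e = e) {c : 𝒜.fiber 1}
    (hc : c ∈ Set.range (𝒜.incl (idem_le_one he))) (h : H) : π.op 1 c h ∈ π.unitSpace e 1 := by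
  obtain ⟨d, rfl⟩ := hc
  rw [π.op_incl]
  exact π.mem_unitSpace he (le_refl' e) d h

theorem star_op_one_apply_mem_unitSpace {e : S} (he : e * e = e) {c : 𝒜.fiber 1}
    (hc : c ∈ Set.range (𝒜.incl (idem_le_one he))) (h : H) :
    star (π.op 1 c) h ∈ π.unitSpace e 1 := by
  obtain ⟨d, rfl⟩ := hc
  rw [π.op_incl, π.op_adj]
  exact π.op_mem_unitSpace (le_of_eq' (by rw [inv_inv', inv_of_idem he, he])) _ h

/-- Along a filter on which the full norm is bounded and the reduced norm tends to zero, the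
action on the vectors `π(c) h δ_r`, `c ∈ A_{r r^*}`, tends to zero. -/
theorem tendsto_auxAct_auxSingle {l : Filter 𝒜.Cc} {B : ℝ}
    (hB : ∀ᶠ x in l, 𝒜.maxSeminorm.toSeminorm x ≤ B)
    (hl : Tendsto (fun x => π.redSeminorm.toSeminorm x) l (𝓝 0)) {r : S} {c : 𝒜.fiber 1}
    (hc : c ∈ Set.range (𝒜.incl (mul_inv_le_one r))) (h : H) :
    Tendsto (fun x => ‖π.auxAct x (π.auxSingle r (π.op 1 c h))‖) l (𝓝 0) := by
  have hee := idem_mul_inv r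
  refine Metric.tendsto_nhds.mpr fun ε hε => ?_
  have hB1 : 0 < |B| + 1 := by positivity
  -- The vector `h` need not lie in the range of `1_{r r^*}`, as the reduced estimate requires. But
  -- `π(c) h` is a limit of vectors `π(c) π(c)^* v`, and `π(c)^* v` does lie there. The constant `D`
  -- depends on `v`, so `v` is fixed before `x`.
  obtain ⟨_, ⟨v, rfl⟩, hv⟩ := Metric.mem_closure_iff.mp
    ((π.op 1 c).apply_mem_closure_range_mul_star h) (ε / 2 / (|B| + 1)) (by positivity)
  obtain ⟨D, hD⟩ := π.norm_auxAct_auxSingle_le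
    (π.star_op_one_apply_mem_unitSpace hee hc v) c
  have hlD : Tendsto (fun x => π.redSeminorm.toSeminorm x * D) l (𝓝 0) := by
    simpa using hl.mul_const D
  filter_upwards [hB, hlD.eventually (gt_mem_nhds (half_pos hε))] with x hxB hxD
  rw [dist_zero_right, norm_norm]
  set w := π.op 1 c h
  set w' := π.op 1 c (star (π.op 1 c) v)
  -- The approximation error is essential, so the full seminorm, bounded by `B` along the filter,
  -- controls it. Using `|B| + 1` keeps the divisor positive.
  have hw : w - w' ∈ π.unitSpace (r * r⁻¹) 1 :=
    Submodule.sub_mem _ (π.op_one_apply_mem_unitSpace hee hc _)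
      (π.op_one_apply_mem_unitSpace hee hc _)
  have h1 : ‖π.auxAct x (π.auxSingle r (w - w'))‖ ≤ (|B| + 1) * ‖w - w'‖ :=
    (π.norm_auxAct_le_maxSeminorm x (π.auxSingle_mem_essAux hw)).trans
      (mul_le_mul (by linarith [le_abs_self B]) (π.norm_auxSingle_le r _) (norm_nonneg _) hB1.le)
  have h2 : (|B| + 1) * ‖w - w'‖ < ε / 2 := by
    rw [dist_eq_norm, lt_div_iff₀' hB1] at hv
    exact hv
  have h3 : π.auxAct x (π.auxSingle r w) =
      π.auxAct x (π.auxSingle r (w - w')) + π.auxAct x (π.auxSingle r w') := by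
    rw [← map_add, ← map_add, sub_add_cancel]
  rw [h3]
  have h4 := hD x
  exact (norm_add_le _ _).trans_lt (by linarith)

/-! ### The operators `H → Aux` defined by functions `S → A_1` -/

/-- The vector `∑_t π(ξ(t)) h δ_t`. -/
noncomputable def auxVector (ξ : S →₀ 𝒜.fiber 1) (h : H) : π.Aux :=
  ξ.sum fun t y => π.auxSingle t (π.op 1 y h)

/-- The condition `ξ(t) ∈ A_{t t^*}` enters here: it places the vectors where the full seminorm
dominates the action. -/
theorem auxVector_mem_essAux {ξ : S →₀ 𝒜.fiber 1}
    (hξ : ∀ s, ξ s ∈ Set.range (𝒜.incl (mul_inv_le_one s))) (h : H) :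
    π.auxVector ξ h ∈ π.essAux :=
  Submodule.sum_mem _ fun t _ => π.auxSingle_mem_essAux
    (π.op_one_apply_mem_unitSpace (idem_mul_inv t) (hξ t) h)

theorem op_one_comm_one (c : 𝒜.fiber 1) (u : S) : π.op 1 c * π.one u = π.one u * π.op 1 c :=
  π.op_idem_comm_one (mul_one 1) c u

theorem star_op_one_comm_one (c : 𝒜.fiber 1) (u : S) :
    star (π.op 1 c) * π.one u = π.one u * star (π.op 1 c) := by
  have h := congrArg star (π.op_one_comm_one c u)
  rw [star_mul, star_mul, star_one] at h
  exact h.symm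

/-- Identifies the compression `V^* σ(a δ_s) V` with the sum in condition (ii). The projections
commute with `π(A_1)`, so `1_{p (s t)^*}` can be moved past `ξ(p)^*`. -/
theorem inner_auxVector_auxAct_single (ξ : S →₀ 𝒜.fiber 1) (h k : H) {s : S} (a : 𝒜.fiber s) :
    inner ℂ (π.auxVector ξ h) (π.auxAct (𝒜.single s a) (π.auxVector ξ k)) =
      inner ℂ h ((ξ.sum fun p x => ξ.sum fun t y =>
        π.one (p * (s * t)⁻¹) * star (π.op 1 x) * π.op s a * π.op 1 y) k) := by
  simp only [auxVector, Finsupp.sum, map_sum, auxAct_single, sum_inner, inner_sum,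
    inner_auxSingle, sum_apply]
  rw [Finset.sum_comm]
  refine Finset.sum_congr rfl fun p _ => Finset.sum_congr rfl fun t _ => ?_
  rw [← star_op_one_comm_one, ContinuousLinearMap.star_eq_adjoint]
  exact (ContinuousLinearMap.adjoint_inner_right (π.op 1 (ξ p)) _ _).symm

/-- Identifies `V^* V` with the sum in condition (i). -/
theorem inner_auxVector_self (ξ : S →₀ 𝒜.fiber 1) (h : H) :
    inner ℂ (π.auxVector ξ h) (π.auxVector ξ h) =
      inner ℂ h ((ξ.sum fun p x => ξ.sum fun t y =>
        star (π.op 1 x) * π.op 1 y * π.one (p * t⁻¹)) h) := by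
  simp only [auxVector, Finsupp.sum, sum_inner, inner_sum, inner_auxSingle,
    sum_apply]
  rw [Finset.sum_comm]
  refine Finset.sum_congr rfl fun p _ => Finset.sum_congr rfl fun t _ => ?_
  rw [mul_assoc, op_one_comm_one, ContinuousLinearMap.star_eq_adjoint]
  exact (ContinuousLinearMap.adjoint_inner_right (π.op 1 (ξ p)) _ _).symm

/-- From `‖V h‖² = ⟪h, V^* V h⟫`: condition (i) bounds the compressing operators uniformly by `√C`.
-/
theorem norm_auxVector_le {ξ : S →₀ 𝒜.fiber 1} {C : ℝ}
    (hC : ‖ξ.sum fun p x => ξ.sum fun t y =>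
      star (π.op 1 x) * π.op 1 y * π.one (p * t⁻¹)‖ ≤ C) (h : H) :
    ‖π.auxVector ξ h‖ ≤ Real.sqrt C * ‖h‖ := by
  refine le_of_sq_le_sq ?_ (by positivity)
  rw [mul_pow, Real.sq_sqrt ((norm_nonneg _).trans hC), norm_sq_eq_re_inner (𝕜 := ℂ),
    inner_auxVector_self]
  refine (RCLike.re_le_norm _).trans ((norm_inner_le_norm _ _).trans ?_)
  have h1 := ContinuousLinearMap.le_of_opNorm_le _ hC h
  calc _ ≤ ‖h‖ * (C * ‖h‖) := mul_le_mul_of_nonneg_left h1 (norm_nonneg h)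
    _ = C * ‖h‖ ^ 2 := by ring

end FellBundle.Rep

/-! ### Injectivity of the regular representation -/

namespace FellBundle

variable {S : Type u} [InverseMonoid S] (𝒜 : FellBundle.{u, v} S)

open Filter Topology

theorem denseRange_toComplHom (p : CStarSeminorm 𝒜.Cc) : DenseRange p.toComplHom :=
  UniformSpace.Completion.denseRange_coe (α := p.Carrier)

/-- The matrix coefficients of the compressed actions converge to those of the universal
representation. -/
theorem tendsto_inner_auxVector {I : Type w} [Preorder I] {ξ : I → (S →₀ 𝒜.fiber 1)}
    (hξ : ∀ (s : S) (a : 𝒜.fiber s),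
      Tendsto (fun i => (ξ i).sum fun p x => (ξ i).sum fun t y =>
        𝒜.univRep.one (p * (s * t)⁻¹) * star (𝒜.univRep.op 1 x) * 𝒜.univRep.op s a *
          𝒜.univRep.op 1 y)
        atTop (𝓝 (𝒜.univRep.op s a))) (h k : 𝒜.UnivSpace) (x : 𝒜.Cc) :
    Tendsto (fun i => inner ℂ (𝒜.univRep.auxVector (ξ i) h)
      (𝒜.univRep.auxAct x (𝒜.univRep.auxVector (ξ i) k))) atTop
      (𝓝 (inner ℂ h (𝒜.univHom (𝒜.maxSeminorm.toComplHom x) k))) := by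
  induction x using Cc.induction with
  | zero => simpa using tendsto_const_nhds
  | add x y hx hy =>
    simp only [map_add, LinearMap.add_apply, add_apply, inner_add_right]
    exact hx.add hy
  | single s a =>
    simp only [Rep.inner_auxVector_auxAct_single]
    have h1 : Continuous fun T : 𝒜.UnivSpace →L[ℂ] 𝒜.UnivSpace => inner ℂ h (T k) := by fun_prop
    exact (h1.tendsto _).comp (hξ s a)

/-- Condition (ii) gives convergence only on sections, whereas a kernel element `b` is a limit of
sections. The uniform bound on the `V_i` permits taking the two limits one after the other. -/
theorem regularRep_injective (h : 𝒜.HasApproximationProperty.{u, v, w}) :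
    Function.Injective 𝒜.regularRep := by
  obtain ⟨I, _, _, _, ξ, hmem, ⟨C, hC⟩, hlim⟩ := h
  rw [injective_iff_map_eq_zero]
  intro b hb
  refine (injective_iff_map_eq_zero _).mp 𝒜.univHom_injective b ?_
  let π := 𝒜.univRep
  let φ := 𝒜.maxSeminorm.toComplHom
  -- The filter of sections approaching `b` in the full norm; it is proper because sections are
  -- dense.
  let l : Filter 𝒜.Cc := comap φ (𝓝 b)
  have : l.NeBot := comap_neBot fun t ht => by
    obtain ⟨_, hy, x, rfl⟩ :=
      mem_closure_iff_nhds.mp (𝒜.denseRange_toComplHom 𝒜.maxSeminorm b) t ht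
    exact ⟨x, hy⟩
  have hφ : Tendsto φ l (𝓝 b) := tendsto_comap
  have hB : ∀ᶠ x in l, 𝒜.maxSeminorm.toSeminorm x ≤ ‖b‖ + 1 := by
    filter_upwards [hφ.norm.eventually (gt_mem_nhds (lt_add_one ‖b‖))] with x hx
    rw [← CStarSeminorm.norm_toComplHom]
    exact hx.le
  -- The reduced seminorm of `x` is the norm of the image of `φ x` under the regular representation,
  -- which tends to that of `b`, namely zero.
  have hred : Tendsto (fun x => π.redSeminorm.toSeminorm x) l (𝓝 0) := by
    have hcont : Continuous 𝒜.regularRep := UniformSpace.Completion.continuous_map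
    have h1 := ((hcont.tendsto b).comp hφ).norm
    rw [hb, norm_zero] at h1
    refine h1.congr fun x => ?_
    rw [← CStarSeminorm.norm_toComplHom]
    exact congrArg norm (CStarSeminorm.mapCompl_toComplHom _ _ _ x)
  have hzero : ∀ i k, Tendsto (fun x => ‖π.auxAct x (π.auxVector (ξ i) k)‖) l (𝓝 0) :=
    fun i k => by
      have h1 : Tendsto (fun x => ∑ t ∈ (ξ i).support,
          ‖π.auxAct x (π.auxSingle t (π.op 1 (ξ i t) k))‖) l (𝓝 0) := by
        rw [← Finset.sum_const_zero (s := (ξ i).support)]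
        exact tendsto_finsetSum _ fun t _ => π.tendsto_auxAct_auxSingle hB hred (hmem i t) k
      refine squeeze_zero (fun _ => norm_nonneg _) (fun x => ?_) h1
      rw [Rep.auxVector, Finsupp.sum, map_sum]
      exact norm_sum_le _ _
  -- Compare `x` with a second section `y → b`: the action of `x - y` is dominated by the full norm,
  -- and that of `y` vanishes in the limit. The resulting bound is independent of `i`.
  have hact : ∀ i k x, ‖π.auxAct x (π.auxVector (ξ i) k)‖ ≤ ‖φ x - b‖ * (√C * ‖k‖) :=
    fun i k x => by
      have hlim1 : Tendsto (fun y => ‖φ x - φ y‖ * (√C * ‖k‖) +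
          ‖π.auxAct y (π.auxVector (ξ i) k)‖) l (𝓝 (‖φ x - b‖ * (√C * ‖k‖) + 0)) :=
        ((hφ.const_sub (φ x)).norm.mul_const _).add (hzero i k)
      rw [add_zero] at hlim1
      refine ge_of_tendsto hlim1 (Eventually.of_forall fun y => ?_)
      have h1 := π.norm_auxAct_le_maxSeminorm (x - y) (π.auxVector_mem_essAux (hmem i) k)
      rw [← CStarSeminorm.norm_toComplHom, map_sub, map_sub, LinearMap.sub_apply] at h1
      have h2 := h1.trans (mul_le_mul_of_nonneg_left (π.norm_auxVector_le (hC i) k)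
        (norm_nonneg _))
      exact (norm_le_norm_sub_add _ (π.auxAct y (π.auxVector (ξ i) k))).trans
        (add_le_add_left h2 _)
  ext1 k
  refine ext_inner_left ℂ fun v => ?_
  -- The limit over `i` for fixed `x`; the limit `x → b` comes afterwards.
  have hx : ∀ x, ‖inner ℂ v (𝒜.univHom (φ x) k)‖ ≤
      √C * ‖v‖ * (‖φ x - b‖ * (√C * ‖k‖)) := fun x =>
    le_of_tendsto (𝒜.tendsto_inner_auxVector hlim v k x).norm (Eventually.of_forall fun i =>
      (norm_inner_le_norm _ _).trans (mul_le_mul (π.norm_auxVector_le (hC i) v) (hact i k x)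
        (norm_nonneg _) (by positivity)))
  have hcont : Continuous 𝒜.univHom :=
    AddMonoidHomClass.continuous_of_bound 𝒜.univHom 1 fun a => by
      rw [one_mul]
      exact NonUnitalStarAlgHom.norm_apply_le 𝒜.univHom a
  have h1 : Tendsto (fun x => ‖inner ℂ v (𝒜.univHom (φ x) k)‖) l
      (𝓝 ‖inner ℂ v (𝒜.univHom b k)‖) := by
    have h2 : Continuous fun T : 𝒜.UnivSpace →L[ℂ] 𝒜.UnivSpace => inner ℂ v (T k) := by fun_prop
    exact (((h2.comp hcont).tendsto b).comp hφ).norm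
  have h2 : Tendsto (fun x => √C * ‖v‖ * (‖φ x - b‖ * (√C * ‖k‖))) l (𝓝 0) := by
    have h3 := (((hφ.sub_const b).norm.mul_const (√C * ‖k‖)).const_mul (√C * ‖v‖))
    simpa using h3
  have h3 := le_of_tendsto_of_tendsto' h1 h2 hx
  rw [zero_apply, inner_zero_right]
  exact norm_le_zero_iff.mp h3

end FellBundle

theorem theorem5p3 {S : Type u} [InverseMonoid S] (𝒜 : FellBundle.{u, v} S)
    (h : 𝒜.HasApproximationProperty.{u, v, w}) : 𝒜.HasWeakContainmentProperty := by
  have hinj := 𝒜.regularRep_injective h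
  refine ⟨hinj, ?_⟩
  -- Isometry together with completeness makes the range closed, and it contains the dense image of
  -- `C_c(𝒜)`.
  have hiso : Isometry 𝒜.regularRep := NonUnitalStarAlgHom.isometry 𝒜.regularRep hinj
  have hdense : DenseRange 𝒜.regularRep :=
    (𝒜.denseRange_toComplHom 𝒜.univRep.redSeminorm).mono (by
      rintro _ ⟨x, rfl⟩
      exact ⟨_, CStarSeminorm.mapCompl_toComplHom _ _ _ x⟩)
  rw [← Set.range_eq_univ, ← hiso.isClosedEmbedding.isClosed_range.closure_eq]
  exact hdense.closure_range
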